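/- Let $U\subseteq\mathbb C$ be a nonempty connected open set. A *difference function* is a function of the lattice variables $u_N\in U$, $N\in\mathbb Z^2$, which depends on only finitely many of them, and holomorphically so; write $u=u_{(0,0)}$ and let $\mathcal A$ be the $\mathbb C$-algebra of difference functions. Let $\mathcal S_1,\mathcal S_2$ be the commuting shifts $\mathcal S_i u_N=u_{N+E_i}$, with $E_1=(1,0)$, $E_2=(0,1)$, and put $\mathcal S^L=\mathcal S_1^{l_1}\mathcal S_2^{l_2}$ for $L=(l_1,l_2)\in\mathbb Z^2$. A (scalar local) difference operator is a finite sum $P=\sum_{L\in\mathbb Z^2}P_L\mathcal S^L$ with $P_L\in\mathcal A$, and operators are multiplied by the rule $\mathcal S^L\circ a=\mathcal S^L(a)\,\mathcal S^L$. Its $\lambda$-bracket is $$\{g_\lambda h\}=\sum_{M,N\in\mathbb Z^2}\frac{\partial h}{\partial u_N}(\lambda\mathcal S)^N P(\lambda\mathcal S)(\lambda\mathcal S)^{-M}\frac{\partial g}{\partial u_M}\in\mathcal A[\lambda_1^{\pm1},\lambda_2^{\pm1}],\qquad g,h\in\mathcal A,$$ and $P$ is *Hamiltonian* if this bracket makes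 $\mathcal A$ a multiplicative Poisson vertex algebra, i.e. if for all $g,h,k\in\mathcal A$ it is skewsymmetric, $\{h_\lambda g\}=-\sum_L(\lambda\mathcal S)^{-L}\big(c_L\big)$ where $\{g_\lambda h\}=\sum_L c_L\lambda^L$, and satisfies the Jacobi identity $\{g_\lambda\{h_\mu k\}\}-\{h_\mu\{g_\lambda k\}\}=\{\{g_\lambda h\}_{\lambda\mu}k\}$. Two Hamiltonian operators $P,Q$ are *compatible* if $P+\eta Q$ is Hamiltonian for every $\eta\in\mathbb C$. Let $f_1,f_2,F$ be holomorphic functions on $U$, with $F$ non-constant and $f_2F'=F$; let $a,b\in\mathbb C$ with $a\neq0$, and let $F^a$ be a holomorphic branch on $U$ of the power of $F$. Let $\alpha,\beta,\gamma,\delta,\epsilon\in\mathbb C$, and let $P$ be the operator $$P=f_1(u)\circ\Big(\alpha\mathcal S_1^2+\beta\mathcal S_1\mathcal S_2+\gamma\mathcal S_2^2+\delta\mathcal S_1+\epsilon\mathcal S_2-\alpha\mathcal S_1^{-2}-\beta\mathcal S_1^{-1}\mathcal S_2^{-1}-\gamma\mathcal S_2^{-2}-\delta\mathcal S_1^{-1}-\epsilon\mathcal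 S_2^{-1}\Big)\circ f_1(u),$$ assumed to be nonzero. For $i=1,2$ let $Q_i$ be the operator (with $f_2=f_2(u)$, $F=F(u)$) $$Q_i=f_2\mathcal S_i\circ F^a\mathcal S_i\circ f_2+f_2\big((F^a+b)\mathcal S_i+\mathcal S_i\circ(F^a+b)\big)\circ f_2-f_2\big((F^a+b)\mathcal S_i^{-1}+\mathcal S_i^{-1}\circ(F^a+b)\big)\circ f_2-f_2\mathcal S_i^{-1}\circ F^a\mathcal S_i^{-1}\circ f_2 .$$ Then: 1. $P$ and $Q_1$ are compatible Hamiltonian operators if and only if $f_2=\kappa f_1$ for some constant $\kappa\in\mathbb C$, $\alpha=\beta=\gamma=0$ and $\epsilon=0$; 2. $P$ and $Q_2$ are compatible Hamiltonian operators if and only if $f_2=\kappa f_1$ for some constant $\kappa\in\mathbb C$, $\alpha=\beta=\gamma=0$ and $\delta=0$. -/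

import Mathlib

namespace DiffHam

open TopologicalSpace

/-- The two-dimensional lattice of shifts. -/
abbrev Lat : Type := ℤ × ℤ

/-- Functions of the lattice variables `u_N`, `N ∈ ℤ²`, `u_N ∈ U`, which depend on finitely many of
them, and holomorphically so. -/
def IsDiffFun (U : Opens ℂ) (φ : (Lat → U) → ℂ) : Prop :=
  ∃ (s : Finset Lat) (g : (s → ℂ) → ℂ),
    AnalyticOnNhd ℂ g {v | ∀ i, v i ∈ U} ∧ ∀ x, φ x = g (fun i => (x i : ℂ))

theorem IsDiffFun.enlarge {U : Opens ℂ} {φ : (Lat → U) → ℂ} {s : Finset Lat} {g : (s → ℂ) → ℂ}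
    (hg : AnalyticOnNhd ℂ g {v | ∀ i, v i ∈ U}) (hφ : ∀ x, φ x = g (fun i => (x i : ℂ)))
    {t : Finset Lat} (e : s → t) (N : Lat) (he : ∀ i, (e i : Lat) = i + N) :
    AnalyticOnNhd ℂ (fun v : t → ℂ => g (fun i => v (e i))) {v | ∀ i, v i ∈ U} ∧
      ∀ x : Lat → U, φ (fun M => x (M + N)) = g (fun i => (x (e i) : ℂ)) := by
  refine ⟨?_, fun x => ?_⟩
  · intro v hv
    let L : (t → ℂ) →L[ℂ] (s → ℂ) :=
      ContinuousLinearMap.pi fun i => ContinuousLinearMap.proj (e i)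
    exact (hg (L v) (fun i => hv (e i))).comp (L.analyticAt v)
  · simp [hφ, he]

theorem IsDiffFun.binop {U : Opens ℂ} {φ ψ : (Lat → U) → ℂ} (hφ : IsDiffFun U φ)
    (hψ : IsDiffFun U ψ) :
    ∃ (s : Finset Lat) (g h : (s → ℂ) → ℂ),
      AnalyticOnNhd ℂ g {v | ∀ i, v i ∈ U} ∧ AnalyticOnNhd ℂ h {v | ∀ i, v i ∈ U} ∧
      (∀ x, φ x = g (fun i => (x i : ℂ))) ∧ ∀ x, ψ x = h (fun i => (x i : ℂ)) := by
  obtain ⟨s, g, hg, hgφ⟩ := hφ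
  obtain ⟨t, h, hh, hhψ⟩ := hψ
  have h1 := IsDiffFun.enlarge hg hgφ (t := s ∪ t)
    (fun i => ⟨i, Finset.mem_union_left t i.2⟩) 0 (by simp)
  have h2 := IsDiffFun.enlarge hh hhψ (t := s ∪ t)
    (fun i => ⟨i, Finset.mem_union_right s i.2⟩) 0 (by simp)
  exact ⟨s ∪ t, _, _, h1.1, h2.1, fun x => by simpa using h1.2 x, fun x => by simpa using h2.2 x⟩

/-- The algebra of difference functions in one generator over `U`. -/
def DiffFun (U : Opens ℂ) : Subalgebra ℂ ((Lat → U) → ℂ) where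
  carrier := {φ | IsDiffFun U φ}
  mul_mem' := by
    intro φ ψ hφ hψ
    obtain ⟨s, g, h, hg, hh, e1, e2⟩ := IsDiffFun.binop hφ hψ
    exact ⟨s, g * h, hg.mul hh, fun x => by simp [e1, e2]⟩
  add_mem' := by
    intro φ ψ hφ hψ
    obtain ⟨s, g, h, hg, hh, e1, e2⟩ := IsDiffFun.binop hφ hψ
    exact ⟨s, g + h, hg.add hh, fun x => by simp [e1, e2]⟩
  algebraMap_mem' := by
    intro c
    exact ⟨∅, fun _ => c, analyticOnNhd_const, fun x => by simp⟩

variable {U : Opens ℂ}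

/-- A function of the single variable `u = u_{(0,0)}`, given by a holomorphic function on `U`. -/
def ofFun (f : ℂ → ℂ) (hf : DifferentiableOn ℂ f U) : DiffFun U :=
  ⟨fun x => f (x 0), {0}, fun v => f (v ⟨0, Finset.mem_singleton_self 0⟩), by
    intro v hv
    let L : (({0} : Finset Lat) → ℂ) →L[ℂ] ℂ :=
      ContinuousLinearMap.proj ⟨0, Finset.mem_singleton_self 0⟩
    exact AnalyticAt.comp (g := f) (f := L)
      (hf.analyticOnNhd U.isOpen _ (hv ⟨0, Finset.mem_singleton_self 0⟩))
      (L.analyticAt v), fun _ => rfl⟩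

/-- The generator `u = u_{(0,0)}`. -/
def gen : DiffFun U := ofFun id differentiableOn_id

/-- The shift `𝒮₁ ^ n₁ 𝒮₂ ^ n₂`, for `N = (n₁, n₂)`: it maps `u_M` to `u_{M + N}`. -/
def shift (N : Lat) (φ : DiffFun U) : DiffFun U :=
  ⟨fun x => φ.1 (fun M => x (M + N)), by
    obtain ⟨s, g, hg, hgφ⟩ := φ.2
    have h1 := IsDiffFun.enlarge hg hgφ (t := s.image (· + N))
      (fun i => ⟨i + N, Finset.mem_image_of_mem _ i.2⟩) N (fun _ => rfl)
    exact ⟨_, _, h1.1, h1.2⟩⟩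

/-- The lattice (written multiplicatively) acts on difference functions by shifts. -/
instance : MulSemiringAction (Multiplicative Lat) (DiffFun U) where
  smul N φ := shift N.toAdd φ
  one_smul φ := by
    apply Subtype.ext; funext x
    change φ.1 (fun M => x (M + 0)) = φ.1 x
    simp
  mul_smul N K φ := by
    apply Subtype.ext; funext x
    change φ.1 (fun M => x (M + (N.toAdd + K.toAdd))) = φ.1 (fun M => x ((M + K.toAdd) + N.toAdd))
    simp only [add_comm (Multiplicative.toAdd N), add_assoc]
  smul_zero _ := rfl
  smul_add _ _ _ := rfl
  smul_one _ := rfl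
  smul_mul _ _ _ := rfl

open Classical in
/-- The partial derivative `∂φ/∂u_N`. The value `0` off the open set `U`
plays no role. -/
noncomputable def pderivFun (N : Lat) (φ : (Lat → U) → ℂ) (x : Lat → U) : ℂ :=
  deriv (fun z : ℂ => if h : z ∈ U then φ (Function.update x N ⟨z, h⟩) else 0) (x N)

theorem isOpen_box (s : Finset Lat) : IsOpen {v : s → ℂ | ∀ i, v i ∈ U} := by
  have : {v : s → ℂ | ∀ i, v i ∈ U} = Set.univ.pi fun _ => (U : Set ℂ) := by
    ext v; simp
  rw [this]
  exact isOpen_set_pi Set.finite_univ fun _ _ => U.isOpen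

open Classical in
theorem pderivFun_of_notMem {s : Finset Lat} {g : (s → ℂ) → ℂ} {φ : (Lat → U) → ℂ}
    (hφ : ∀ x, φ x = g (fun i => (x i : ℂ))) {N : Lat} (hN : N ∉ s) (x : Lat → U) :
    pderivFun N φ x = 0 := by
  have : (fun z : ℂ => if h : z ∈ U then φ (Function.update x N ⟨z, h⟩) else 0)
      =ᶠ[nhds (x N : ℂ)] fun _ => φ x := by
    filter_upwards [U.isOpen.mem_nhds (x N).2] with z hz
    have hz' : z ∈ U := hz
    simp only [hz', dite_true, hφ]
    congr 1; funext i
    have : (i : Lat) ≠ N := fun h => hN (h ▸ i.2)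
    simp [Function.update_of_ne this]
  rw [pderivFun, this.deriv_eq, deriv_const]

open Classical in
theorem pderivFun_of_mem {s : Finset Lat} {g : (s → ℂ) → ℂ} {φ : (Lat → U) → ℂ}
    (hg : AnalyticOnNhd ℂ g {v | ∀ i, v i ∈ U})
    (hφ : ∀ x, φ x = g (fun i => (x i : ℂ))) {N : Lat} (hN : N ∈ s) (x : Lat → U) :
    pderivFun N φ x = fderiv ℂ g (fun i => (x i : ℂ)) (Pi.single ⟨N, hN⟩ 1) := by
  have : (fun z : ℂ => if h : z ∈ U then φ (Function.update x N ⟨z, h⟩) else 0)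
      =ᶠ[nhds (x N : ℂ)]
        fun z => g (Function.update (fun i : s => (x i : ℂ)) ⟨N, hN⟩ z) := by
    filter_upwards [U.isOpen.mem_nhds (x N).2] with z hz
    have hz' : z ∈ U := hz
    simp only [hz', dite_true, hφ]
    congr 1; funext i
    by_cases h : (i : Lat) = N
    · obtain ⟨i, hi⟩ := i
      subst h
      simp
    · have h' : i ≠ ⟨N, hN⟩ := fun e => h (by rw [e])
      simp [Function.update_of_ne h, Function.update_of_ne h']
  rw [pderivFun, this.deriv_eq]
  have hx : Function.update (fun i : s => (x i : ℂ)) ⟨N, hN⟩ (x N : ℂ) = fun i : s => (x i : ℂ) :=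
    Function.update_eq_self (⟨N, hN⟩ : s) (fun i : s => (x i : ℂ))
  have hd : HasFDerivAt g (fderiv ℂ g (fun i : s => (x i : ℂ)))
      (Function.update (fun i : s => (x i : ℂ)) ⟨N, hN⟩ (x N : ℂ)) := by
    rw [hx]
    exact (hg _ (fun i => (x i).2)).differentiableAt.hasFDerivAt
  exact (hd.comp_hasDerivAt (x N : ℂ) (hasDerivAt_update _ _ _)).deriv

/-- The partial derivative `∂/∂u_N` on difference functions. -/
noncomputable def pderiv (N : Lat) (φ : DiffFun U) : DiffFun U :=
  ⟨pderivFun N φ.1, by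
    obtain ⟨s, g, hg, hgφ⟩ := φ.2
    by_cases hN : N ∈ s
    · refine ⟨s, fun v => fderiv ℂ g v (Pi.single ⟨N, hN⟩ 1), ?_, fun x => ?_⟩
      · intro v hv
        exact ((ContinuousLinearMap.apply ℂ ℂ (Pi.single ⟨N, hN⟩ 1 : s → ℂ)).analyticAt _).comp
          (hg.fderiv v hv)
      · exact pderivFun_of_mem hg hgφ hN x
    · exact ⟨∅, fun _ => 0, analyticOnNhd_const, fun x => pderivFun_of_notMem hgφ hN x⟩⟩

theorem pderiv_finite (φ : DiffFun U) : (Function.support fun N => pderiv N φ).Finite := by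
  obtain ⟨s, g, hg, hgφ⟩ := φ.2
  refine s.finite_toSet.subset fun N hN => ?_
  by_contra h
  refine hN (Subtype.ext (funext fun x => ?_))
  exact pderivFun_of_notMem hgφ (by simpa using h) x

/-- All the partial derivatives `∂φ/∂u_N`, finitely many of which are nonzero. -/
noncomputable def grad (φ : DiffFun U) : Lat →₀ DiffFun U :=
  Finsupp.ofSupportFinite (fun N => pderiv N φ) (pderiv_finite φ)

/-- Scalar local difference operators `∑_L P_L 𝒮^L`: the product is determined by
`𝒮^L ∘ a = 𝒮^L(a) 𝒮^L`. -/
abbrev DiffOp (U : Opens ℂ) : Type := SkewMonoidAlgebra (DiffFun U) (Multiplicative Lat)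

/-- The operator `𝒮₁ ^ m 𝒮₂ ^ n`. -/
noncomputable def Sh (U : Opens ℂ) (m n : ℤ) : DiffOp U := SkewMonoidAlgebra.single (Multiplicative.ofAdd (m, n)) 1

/-- The operator of multiplication by a difference function. -/
noncomputable def mulOp (a : DiffFun U) : DiffOp U := SkewMonoidAlgebra.single 1 a

/-- The `λ`-bracket of the operator `P`, by the master formula
`{φ_λ ψ} = ∑_{M,N} ∂ψ/∂u_N (λ𝒮)^N P(λ𝒮) (λ𝒮)^{-M} ∂φ/∂u_M`, so that `{u_λ u} = ∑_L P_L λ^L`.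
A Laurent polynomial `∑_K c_K λ^K` is recorded by its coefficients `c_K`. -/
noncomputable def bracket (P : DiffOp U) (φ ψ : DiffFun U) : Lat →₀ DiffFun U :=
  (grad ψ).sum fun N b => P.sum fun T p => (grad φ).sum fun M a =>
    Finsupp.single (N + T.toAdd - M) (b * shift N p * shift (N + T.toAdd - M) a)

/-- For `b = ∑_L b_L λ^L`, the Laurent polynomial `∑_L (λ𝒮)^{-L} b_L`, in which the shifts act on
the coefficients. -/
noncomputable def reflect (b : Lat →₀ DiffFun U) : Lat →₀ DiffFun U :=
  b.sum fun L c => Finsupp.single (-L) (shift (-L) c)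

/-- `{φ_λ {ψ_μ χ}}`; the coefficient of `λ^L μ^K` is the value at `(L, K)`. -/
noncomputable def nestedRight (P : DiffOp U) (φ ψ χ : DiffFun U) : Lat × Lat →₀ DiffFun U :=
  (bracket P ψ χ).sum fun K c => (bracket P φ c).sum fun L d => Finsupp.single (L, K) d

/-- `{ψ_μ {φ_λ χ}}`; the coefficient of `λ^L μ^K` is the value at `(L, K)`. -/
noncomputable def nestedMiddle (P : DiffOp U) (φ ψ χ : DiffFun U) : Lat × Lat →₀ DiffFun U :=
  (bracket P φ χ).sum fun L c => (bracket P ψ c).sum fun K d => Finsupp.single (L, K) d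

/-- `{{φ_λ ψ}_{λμ} χ}`; the coefficient of `λ^L μ^K` is the value at `(L, K)`. -/
noncomputable def nestedLeft (P : DiffOp U) (φ ψ χ : DiffFun U) : Lat × Lat →₀ DiffFun U :=
  (bracket P φ ψ).sum fun L c => (bracket P c χ).sum fun K d => Finsupp.single (L + K, K) d

/-- `P` is Hamiltonian: its `λ`-bracket (which is sesquilinear and satisfies the Leibniz rules, by
the form of the master formula) is skewsymmetric and satisfies the Jacobi identity, so that it is a
multiplicative Poisson vertex algebra structure on the algebra of difference functions. -/
structure IsHamiltonian (P : DiffOp U) : Prop where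
  skew : ∀ φ ψ : DiffFun U, bracket P ψ φ = -reflect (bracket P φ ψ)
  jacobi : ∀ φ ψ χ : DiffFun U,
    nestedRight P φ ψ χ - nestedMiddle P φ ψ χ = nestedLeft P φ ψ χ

/-- Two Hamiltonian operators are compatible if all `P + η Q` are Hamiltonian. -/
def Compatible (P Q : DiffOp U) : Prop :=
  IsHamiltonian P ∧ IsHamiltonian Q ∧ ∀ η : ℂ, IsHamiltonian (P + η • Q)

/-- The operator of general form
`f ∘ (α 𝒮₁² + β 𝒮₁𝒮₂ + γ 𝒮₂² + δ 𝒮₁ + ε 𝒮₂ - (𝒮ᵢ ↔ 𝒮ᵢ⁻¹)) ∘ f`. -/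
noncomputable def generalOp (f : DiffFun U) (α β γ δ ε : ℂ) : DiffOp U :=
  mulOp f *
    ((α • Sh U 2 0 + β • Sh U 1 1 + γ • Sh U 0 2 + δ • Sh U 1 0 + ε • Sh U 0 1) -
      (α • Sh U (-2) 0 + β • Sh U (-1) (-1) + γ • Sh U 0 (-2) + δ • Sh U (-1) 0 + ε • Sh U 0 (-1))) *
    mulOp f

/-- With `S` a shift, `S'` its inverse, and `W` the power `F^a`, the operator
`f S ∘ W S ∘ f + f ((W + b) S + S ∘ (W + b)) ∘ f - f ((W + b) S⁻¹ + S⁻¹ ∘ (W + b)) ∘ f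
- f S⁻¹ ∘ W S⁻¹ ∘ f`. -/
noncomputable def oneDimOp (S S' : DiffOp U) (f W : DiffFun U) (b : ℂ) : DiffOp U :=
  mulOp f * S * mulOp W * S * mulOp f
    + mulOp f * (mulOp (W + algebraMap ℂ _ b) * S + S * mulOp (W + algebraMap ℂ _ b)) * mulOp f
    - mulOp f * (mulOp (W + algebraMap ℂ _ b) * S' + S' * mulOp (W + algebraMap ℂ _ b)) * mulOp f
    - mulOp f * S' * mulOp W * S' * mulOp f

/-- `oneDimOp` along the first lattice direction. -/
noncomputable def oneDimOp₁ (f W : DiffFun U) (b : ℂ) : DiffOp U :=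
  oneDimOp (Sh U 1 0) (Sh U (-1) 0) f W b

/-- `oneDimOp` along the second lattice direction. -/
noncomputable def oneDimOp₂ (f W : DiffFun U) (b : ℂ) : DiffOp U :=
  oneDimOp (Sh U 0 1) (Sh U 0 (-1)) f W b

/-- `W` is, on `U`, a branch of the power `F^a`: near every point of `U` which is not a zero of `F`,
one has `W = exp (a L)` for a holomorphic branch `L` of the logarithm of `F`. -/
def IsPowBranch (U : Opens ℂ) (F : ℂ → ℂ) (a : ℂ) (W : ℂ → ℂ) : Prop :=
  ∀ z ∈ U, F z ≠ 0 → ∃ L : ℂ → ℂ, AnalyticAt ℂ L z ∧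
    ∀ᶠ w in nhds z, F w = Complex.exp (L w) ∧ W w = Complex.exp (a * L w)

end DiffHam

/-! The coefficient of `λ^L` in the bracket of `φ` and `ψ` is an ordinary bracket of `𝒮^L φ` with
`ψ` (`bracket_apply`). A Hamiltonian operator is therefore a shift-invariant Poisson bracket on the
coordinates `u_A`, with `{u_A, u_B} = kern P A B`. Bracketing is a derivation in each argument, so
skewsymmetry and Jacobi can be tested on coordinates (`isHamiltonian_of_coord`).

For `P` the kernel is `f₁(u_A) f₁(u_B) c(A - B)` with `c` odd and finitely supported. For `Q` it is
`f₂(u_A) f₂(u_B) V(A, B)`, where `V` joins only points at distance one or two along the direction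
`e` and is affine in the values of `W = F^a`. From `f₂ F' = F` follows `f₂ W' = a W`: in a local
coordinate `v` with `dv = du / f₂`, `W` is an exponential `exp (a v)` up to a constant and `V` is
the bracket itself.

Sufficiency: if `f₂ = κ f₁` and only the first-order term along `e` remains in `P`, then `P + η Q`
has the same shape as `Q`, with `η` multiplying `W` and another additive constant. All these
operators are covered by one polynomial identity, `volterra_jacobi`.

Necessity: the Jacobiator is quadratic in the operator, so compatibility makes its polarisation
vanish (`mixed_jacobi`). On the line `ℤ e`, the triples `(4e, 2e, 0)` and `(3e, 2e, 0)` give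
functional equations in independent variables, which force `c(2e) = 0` because `W` is not constant,
and then `c(e) = 0` or a vanishing Wronskian of `f₁` and `f₂`. The triple `(A, 2e, 0)` with `A` off
the line gives a three-term relation with nonzero middle coefficient, which annihilates every
coefficient off the line. As `P ≠ 0`, the coefficient `c(e)` survives, so `f₂ = κ f₁`. -/

namespace DiffHam
open TopologicalSpace
variable {U : Opens ℂ}

/-! ### Partial derivatives of difference functions -/

open Classical in
/-- The function `z ↦ φ(x)` with the variable `x_N` replaced by `z`. -/
noncomputable def slice (N : Lat) (φ : (Lat → U) → ℂ) (x : Lat → U) (z : ℂ) : ℂ :=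
  if h : z ∈ U then φ (Function.update x N ⟨z, h⟩) else 0

theorem slice_of_mem (N : Lat) (φ : (Lat → U) → ℂ) (x : Lat → U) {z : ℂ} (hz : z ∈ U) :
    slice N φ x z = φ (Function.update x N ⟨z, hz⟩) := by
  simp [slice, hz]

theorem slice_self (N : Lat) (φ : (Lat → U) → ℂ) (x : Lat → U) :
    slice N φ x (x N) = φ x := by
  rw [slice_of_mem N φ x (x N).2]; simp

theorem pderiv_apply (N : Lat) (φ : DiffFun U) (x : Lat → U) :
    (pderiv N φ).1 x = deriv (slice N φ.1 x) (x N) := rfl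

theorem eventuallyEq_slice {N : Lat} {φ : (Lat → U) → ℂ} {x : Lat → U} {k : ℂ → ℂ}
    (h : ∀ z (hz : z ∈ U), φ (Function.update x N ⟨z, hz⟩) = k z) :
    slice N φ x =ᶠ[nhds (x N : ℂ)] k := by
  filter_upwards [U.isOpen.mem_nhds (x N).2] with z hz
  rw [slice_of_mem N φ x hz, h]

theorem differentiableAt_slice (N : Lat) (φ : DiffFun U) (x : Lat → U) :
    DifferentiableAt ℂ (slice N φ.1 x) (x N) := by
  obtain ⟨s, g, hg, hgφ⟩ := φ.2
  have h : slice N φ.1 x =ᶠ[nhds (x N : ℂ)]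
      fun z => g (fun i : s => if (i : Lat) = N then z else x i) := by
    refine eventuallyEq_slice fun z hz => ?_
    rw [hgφ]
    congr 1; funext i
    by_cases hi : (i : Lat) = N
    · rw [hi]; simp
    · simp [hi]
  refine DifferentiableAt.congr_of_eventuallyEq ?_ h
  have hx : (fun i : s => if (i : Lat) = N then (x N : ℂ) else x i) = fun i : s => (x i : ℂ) := by
    funext i; split_ifs with hi
    · rw [hi]
    · rfl
  refine DifferentiableAt.comp (x N : ℂ) (g := g)
    (f := fun z => fun i : s => if (i : Lat) = N then z else (x i : ℂ)) ?_ ?_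
  · rw [hx]; exact (hg _ fun i => (x i).2).differentiableAt
  · refine differentiableAt_pi.2 fun i => ?_
    by_cases hi : (i : Lat) = N <;> simp [hi]

theorem DiffFun.ext {φ ψ : DiffFun U} (h : ∀ x, φ.1 x = ψ.1 x) : φ = ψ :=
  Subtype.ext (funext h)

theorem pderiv_add (N : Lat) (φ ψ : DiffFun U) : pderiv N (φ + ψ) = pderiv N φ + pderiv N ψ := by
  refine DiffFun.ext fun x => ?_
  change deriv (slice N _ x) (x N : ℂ) =
    deriv (slice N _ x) (x N : ℂ) + deriv (slice N _ x) (x N : ℂ)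
  have h : slice N (φ + ψ).1 x =ᶠ[nhds (x N : ℂ)] slice N φ.1 x + slice N ψ.1 x :=
    eventuallyEq_slice fun z hz => by
      simp [slice_of_mem _ _ _ hz]
  exact h.deriv_eq.trans (deriv_add (differentiableAt_slice N φ x) (differentiableAt_slice N ψ x))

theorem pderiv_smul (N : Lat) (c : ℂ) (φ : DiffFun U) : pderiv N (c • φ) = c • pderiv N φ := by
  refine DiffFun.ext fun x => ?_
  change deriv (slice N _ x) (x N : ℂ) = c * deriv (slice N _ x) (x N : ℂ)
  have h : slice N (c • φ).1 x =ᶠ[nhds (x N : ℂ)] fun z => c * slice N φ.1 x z :=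
    eventuallyEq_slice fun z hz => by
      simp [slice_of_mem _ _ _ hz]
  exact h.deriv_eq.trans (deriv_const_mul c (differentiableAt_slice N φ x))

theorem pderiv_mul (N : Lat) (φ ψ : DiffFun U) :
    pderiv N (φ * ψ) = φ * pderiv N ψ + ψ * pderiv N φ := by
  refine DiffFun.ext fun x => ?_
  change deriv (slice N _ x) (x N : ℂ) =
    φ.1 x * deriv (slice N _ x) (x N : ℂ) + ψ.1 x * deriv (slice N _ x) (x N : ℂ)
  have h : slice N (φ * ψ).1 x =ᶠ[nhds (x N : ℂ)] slice N φ.1 x * slice N ψ.1 x :=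
    eventuallyEq_slice fun z hz => by
      simp [slice_of_mem _ _ _ hz]
  refine h.deriv_eq.trans ?_
  rw [deriv_mul (differentiableAt_slice N φ x) (differentiableAt_slice N ψ x), slice_self,
    slice_self]
  ring

theorem pderiv_comm (M N : Lat) (φ : DiffFun U) :
    pderiv M (pderiv N φ) = pderiv N (pderiv M φ) := by
  obtain ⟨s, g, hg, hgφ⟩ := φ.2
  -- A variable on which `φ` does not depend makes both mixed derivatives vanish; otherwise they are
  -- entries of one second Fréchet derivative, which is symmetric.
  have off : ∀ (M N : Lat), N ∉ s → pderiv M (pderiv N φ) = pderiv N (pderiv M φ) := by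
    intro M N hN
    have h0 : pderiv N φ = 0 := DiffFun.ext fun x => pderivFun_of_notMem hgφ hN x
    have h1 : pderiv M (0 : DiffFun U) = 0 := by simpa using pderiv_smul M 0 (0 : DiffFun U)
    rw [h0, h1]
    refine (DiffFun.ext fun x => ?_).symm
    by_cases hM : M ∈ s
    · exact pderivFun_of_notMem (s := s)
        (g := fun v => fderiv ℂ g v (Pi.single ⟨M, hM⟩ 1))
        (fun x => pderivFun_of_mem hg hgφ hM x) hN x
    · exact pderivFun_of_notMem (s := s) (g := fun _ => 0)
        (fun x => pderivFun_of_notMem hgφ hM x) hN x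
  by_cases hN : N ∈ s
  swap
  · exact off M N hN
  by_cases hM : M ∈ s
  swap
  · exact (off N M hM).symm
  have key : ∀ (M N : Lat) (hM : M ∈ s) (hN : N ∈ s) (x : Lat → U),
      (pderiv M (pderiv N φ)).1 x =
        fderiv ℂ (fderiv ℂ g) (fun i => (x i : ℂ)) (Pi.single ⟨M, hM⟩ 1)
          (Pi.single ⟨N, hN⟩ 1) := by
    intro M N hM hN x
    have han : AnalyticOnNhd ℂ (fun v => fderiv ℂ g v (Pi.single ⟨N, hN⟩ 1))
        {v | ∀ i, v i ∈ U} := fun v hv =>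
      ((ContinuousLinearMap.apply ℂ ℂ (Pi.single ⟨N, hN⟩ 1 : s → ℂ)).analyticAt _).comp
          (hg.fderiv v hv)
    refine (pderivFun_of_mem han (fun x => pderivFun_of_mem hg hgφ hN x) hM x).trans ?_
    rw [fderiv_clm_apply (hg.fderiv _ fun i => (x i).2).differentiableAt
      (differentiableAt_const _)]
    simp
  refine DiffFun.ext fun x => ?_
  rw [key M N hM hN, key N M hN hM]
  have hs : IsSymmSndFDerivAt ℂ g (fun i => (x i : ℂ)) :=
    (hg _ fun i => (x i).2).contDiffAt (n := ⊤) |>.isSymmSndFDerivAt (by simp)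
  exact hs.eq _ _

theorem pderiv_shift (N L : Lat) (φ : DiffFun U) :
    pderiv (N + L) (shift L φ) = shift L (pderiv N φ) := by
  refine DiffFun.ext fun x => ?_
  change deriv (slice _ _ _) _ = deriv (slice _ _ _) _
  refine Filter.EventuallyEq.deriv_eq (eventuallyEq_slice fun z hz => ?_)
  rw [slice_of_mem _ _ _ hz]
  refine congrArg φ.1 (funext fun M => ?_)
  by_cases hM : M = N
  · simp [hM]
  · have : M + L ≠ N + L := by simpa using hM
    simp [hM]

/-! ### Vector fields in infinitely many variables -/

/-- The vector field `∑_B a_B ∂/∂u_B`, as a derivation of difference functions. -/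
noncomputable def vectorFieldFun (a : Lat → DiffFun U) (φ : DiffFun U) : DiffFun U :=
  (grad φ).sum fun B d => a B * d

theorem vectorFieldFun_eq_sum (a : Lat → DiffFun U) (φ : DiffFun U) {s : Finset Lat}
    (hs : (grad φ).support ⊆ s) : vectorFieldFun a φ = ∑ B ∈ s, a B * pderiv B φ :=
  Finsupp.sum_of_support_subset _ hs _ fun _ _ => mul_zero _

theorem pderiv_of_notMem_support {φ : DiffFun U} {B : Lat} (h : B ∉ (grad φ).support) :
    pderiv B φ = 0 := Finsupp.notMem_support_iff.1 h

theorem grad_support_subset {φ : DiffFun U} {s : Finset Lat} (h : ∀ B ∉ s, pderiv B φ = 0) :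
    (grad φ).support ⊆ s := fun B hB => by
  by_contra hs
  exact Finsupp.mem_support_iff.1 hB (h B hs)

/-- No finiteness is asked of the coefficients: each difference function depends on finitely many
variables, and two of them can be treated over a common finite set. -/
noncomputable def vectorField (a : Lat → DiffFun U) : Derivation ℂ (DiffFun U) (DiffFun U) :=
  Derivation.mk'
    { toFun := vectorFieldFun a
      map_add' := fun φ ψ => by
        let s := (grad φ).support ∪ (grad ψ).support
        rw [vectorFieldFun_eq_sum a φ (s := s) Finset.subset_union_left,
          vectorFieldFun_eq_sum a ψ (s := s) Finset.subset_union_right,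
          vectorFieldFun_eq_sum a (φ + ψ) (s := s), ← Finset.sum_add_distrib]
        · simp only [pderiv_add, mul_add]
        · refine grad_support_subset fun B hB => ?_
          rw [Finset.notMem_union] at hB
          rw [pderiv_add, pderiv_of_notMem_support hB.1, pderiv_of_notMem_support hB.2, add_zero]
      map_smul' := fun c φ => by
        rw [vectorFieldFun_eq_sum a φ subset_rfl,
          vectorFieldFun_eq_sum a (c • φ) (s := (grad φ).support), RingHom.id_apply,
          Finset.smul_sum]
        · simp only [pderiv_smul, mul_smul_comm]
        · refine grad_support_subset fun B hB => ?_
          rw [pderiv_smul, pderiv_of_notMem_support hB, smul_zero] }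
    fun φ ψ => by
      let s := (grad φ).support ∪ (grad ψ).support
      change vectorFieldFun a (φ * ψ) = φ * vectorFieldFun a ψ + ψ * vectorFieldFun a φ
      rw [vectorFieldFun_eq_sum a φ (s := s) Finset.subset_union_left,
        vectorFieldFun_eq_sum a ψ (s := s) Finset.subset_union_right,
        vectorFieldFun_eq_sum a (φ * ψ) (s := s), Finset.mul_sum, Finset.mul_sum,
        ← Finset.sum_add_distrib]
      · refine Finset.sum_congr rfl fun B _ => ?_
        rw [pderiv_mul]; ring
      · refine grad_support_subset fun B hB => ?_
        rw [Finset.notMem_union] at hB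
        rw [pderiv_mul, pderiv_of_notMem_support hB.1, pderiv_of_notMem_support hB.2]; simp

theorem vectorField_eq_sum (a : Lat → DiffFun U) (φ : DiffFun U) {s : Finset Lat}
    (hs : (grad φ).support ⊆ s) : vectorField a φ = ∑ B ∈ s, a B * pderiv B φ :=
  vectorFieldFun_eq_sum a φ hs

theorem vectorField_add (a b : Lat → DiffFun U) (φ : DiffFun U) :
    vectorField (a + b) φ = vectorField a φ + vectorField b φ := by
  simp only [vectorField_eq_sum _ φ subset_rfl, Pi.add_apply, add_mul, Finset.sum_add_distrib]

theorem vectorField_zero (φ : DiffFun U) : vectorField (0 : Lat → DiffFun U) φ = 0 := by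
  simp [vectorField_eq_sum _ φ subset_rfl]

/-- The second-order terms cancel by symmetry of mixed partial derivatives, so the commutator is
again a vector field and is determined by its values on coordinates. -/
theorem vectorField_commutator (a b : Lat → DiffFun U) (φ : DiffFun U) :
    vectorField a (vectorField b φ) - vectorField b (vectorField a φ) =
      vectorField (fun B => vectorField a (b B) - vectorField b (a B)) φ := by
  set s := (grad φ).support
  have expand : ∀ a b : Lat → DiffFun U, vectorField a (vectorField b φ) =
      ∑ B ∈ s, vectorField a (b B) * pderiv B φ
        + ∑ B ∈ s, ∑ C ∈ s, a C * b B * pderiv C (pderiv B φ) := by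
    intro a b
    rw [vectorField_eq_sum b φ (s := s) subset_rfl, map_sum, ← Finset.sum_add_distrib]
    refine Finset.sum_congr rfl fun B _ => ?_
    have h : vectorField a (pderiv B φ) = ∑ C ∈ s, a C * pderiv C (pderiv B φ) := by
      refine vectorField_eq_sum a _ (grad_support_subset fun C hC => ?_)
      rw [pderiv_comm, pderiv_of_notMem_support hC]
      simpa using pderiv_smul B 0 (0 : DiffFun U)
    rw [Derivation.leibniz, h, smul_eq_mul, smul_eq_mul, Finset.mul_sum, add_comm]
    congr 1
    · ring
    · exact Finset.sum_congr rfl fun C _ => by ring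
  rw [expand a b, expand b a, vectorField_eq_sum _ φ (s := s) subset_rfl,
    Finset.sum_comm (f := fun B C => b C * a B * pderiv C (pderiv B φ))]
  simp only [sub_mul, Finset.sum_sub_distrib]
  rw [add_sub_add_comm, add_eq_left, sub_eq_zero]
  refine Finset.sum_congr rfl fun B _ => Finset.sum_congr rfl fun C _ => ?_
  rw [pderiv_comm]; ring

theorem shift_add_apply (L : Lat) (φ ψ : DiffFun U) : shift L (φ + ψ) = shift L φ + shift L ψ := rfl

theorem shift_mul_apply (L : Lat) (φ ψ : DiffFun U) : shift L (φ * ψ) = shift L φ * shift L ψ := rfl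

theorem shift_shift (L K : Lat) (φ : DiffFun U) : shift L (shift K φ) = shift (K + L) φ := by
  refine DiffFun.ext fun x => ?_
  refine congrArg φ.1 (funext fun M => ?_)
  simp only [add_assoc, add_comm K]

theorem shift_zero_left (φ : DiffFun U) : shift 0 φ = φ :=
  one_smul (Multiplicative Lat) φ

/-- The shift as an additive homomorphism. -/
def shiftHom (L : Lat) : DiffFun U →+ DiffFun U where
  toFun := shift L
  map_zero' := rfl
  map_add' _ _ := rfl

theorem shift_vectorField (L : Lat) (a : Lat → DiffFun U) (φ : DiffFun U) :
    shift L (vectorField a φ) = vectorField (fun B => shift L (a (B - L))) (shift L φ) := by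
  rw [vectorField_eq_sum a φ subset_rfl,
    vectorField_eq_sum _ (shift L φ) (s := (grad φ).support.image (· + L)),
    Finset.sum_image (by simp)]
  · refine (map_sum (shiftHom L) _ _).trans (Finset.sum_congr rfl fun B _ => ?_)
    rw [pderiv_shift, add_sub_cancel_right]
    rfl
  · refine grad_support_subset fun B hB => ?_
    have h : B - L ∉ (grad φ).support := fun h => hB (Finset.mem_image.2 ⟨_, h, by simp⟩)
    have h1 := pderiv_shift (B - L) L φ
    rw [sub_add_cancel] at h1
    rw [h1, pderiv_of_notMem_support h]
    rfl

/-- The function `f(u_A)`. -/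
def ofFunAt (f : ℂ → ℂ) (hf : DifferentiableOn ℂ f U) (A : Lat) : DiffFun U := shift A (ofFun f hf)

theorem ofFunAt_apply (f : ℂ → ℂ) (hf : DifferentiableOn ℂ f U) (A : Lat) (x : Lat → U) :
    (ofFunAt f hf A).1 x = f (x A) := by
  change f (x (0 + A)) = _
  rw [zero_add]

theorem pderiv_ofFunAt (f : ℂ → ℂ) (hf : DifferentiableOn ℂ f U) (A B : Lat) :
    pderiv B (ofFunAt f hf A) =
      if B = A then ofFunAt (deriv f) (hf.deriv U.isOpen) A else 0 := by
  refine DiffFun.ext fun x => ?_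
  split_ifs with h
  · subst h
    rw [ofFunAt_apply, pderiv_apply]
    refine Filter.EventuallyEq.deriv_eq (eventuallyEq_slice fun z hz => ?_)
    rw [ofFunAt_apply]; simp
  · rw [pderiv_apply]
    have : slice B (ofFunAt f hf A).1 x =ᶠ[nhds (x B : ℂ)] fun _ => f (x A) :=
      eventuallyEq_slice fun z hz => by
        rw [ofFunAt_apply, Function.update_of_ne (Ne.symm h)]
    rw [this.deriv_eq, deriv_const]
    rfl

theorem vectorField_ofFunAt (a : Lat → DiffFun U) (f : ℂ → ℂ) (hf : DifferentiableOn ℂ f U)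
    (A : Lat) :
    vectorField a (ofFunAt f hf A) = a A * ofFunAt (deriv f) (hf.deriv U.isOpen) A := by
  rw [vectorField_eq_sum a _ (s := {A}), Finset.sum_singleton, pderiv_ofFunAt, if_pos rfl]
  refine grad_support_subset fun B hB => ?_
  rw [pderiv_ofFunAt, if_neg (by simpa using hB)]

/-- The coordinate function `u_A`. -/
def coord (A : Lat) : DiffFun U := shift A gen

theorem vectorField_coord (a : Lat → DiffFun U) (A : Lat) : vectorField a (coord A) = a A := by
  have h := vectorField_ofFunAt (U := U) a id differentiableOn_id A
  have h1 : ofFunAt (deriv id) ((differentiableOn_id (𝕜 := ℂ)).deriv U.isOpen) A = 1 :=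
    DiffFun.ext fun x => by rw [ofFunAt_apply]; simp
  rw [h1, mul_one] at h
  exact h

/-! ### The shift-invariant bracket on coordinates -/

/-- The bracket `{u_A, u_B}` of the coordinates. -/
noncomputable def kern (P : DiffOp U) (A B : Lat) : DiffFun U :=
  shift B (P.coeff (Multiplicative.ofAdd (A - B)))

theorem shift_kern (P : DiffOp U) (L A B : Lat) :
    shift L (kern P A B) = kern P (A + L) (B + L) := by
  rw [kern, kern, shift_shift, add_sub_add_right_eq_sub]

/-- The vector field `{φ, ·}`. -/
noncomputable def hamField (P : DiffOp U) (φ : DiffFun U) (B : Lat) : DiffFun U :=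
  vectorField (fun A => kern P A B) φ

/-- The bracket `{φ, ψ} = ∑_{A,B} ∂φ/∂u_A ∂ψ/∂u_B {u_A, u_B}`. -/
noncomputable def poisson (P : DiffOp U) (φ ψ : DiffFun U) : DiffFun U :=
  vectorField (hamField P φ) ψ

theorem poisson_eq_sum (P : DiffOp U) (φ ψ : DiffFun U) :
    poisson P φ ψ = ∑ B ∈ (grad ψ).support, ∑ A ∈ (grad φ).support,
      kern P A B * pderiv A φ * pderiv B ψ := by
  rw [poisson, vectorField_eq_sum _ ψ subset_rfl]
  refine Finset.sum_congr rfl fun B _ => ?_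
  rw [hamField, vectorField_eq_sum _ φ subset_rfl, Finset.sum_mul]

theorem poisson_antisymm {P : DiffOp U} (hP : ∀ A B, kern P A B = -kern P B A)
    (φ ψ : DiffFun U) : poisson P φ ψ = -poisson P ψ φ := by
  rw [poisson_eq_sum, poisson_eq_sum, Finset.sum_comm, ← Finset.sum_neg_distrib]
  refine Finset.sum_congr rfl fun A _ => ?_
  rw [← Finset.sum_neg_distrib]
  refine Finset.sum_congr rfl fun B _ => ?_
  rw [hP A B]; ring

theorem shift_poisson (P : DiffOp U) (L : Lat) (φ ψ : DiffFun U) :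
    shift L (poisson P φ ψ) = poisson P (shift L φ) (shift L ψ) := by
  rw [poisson, shift_vectorField, poisson]
  congr 2; funext B
  rw [hamField, shift_vectorField, hamField]
  congr 2; funext A
  rw [shift_kern, sub_add_cancel, sub_add_cancel]

theorem poisson_coord (P : DiffOp U) (A : Lat) (φ : DiffFun U) :
    poisson P (coord A) φ = vectorField (kern P A) φ := by
  rw [poisson]
  congr 2; funext B
  rw [hamField, vectorField_coord]

theorem poisson_coord_coord (P : DiffOp U) (A B : Lat) :
    poisson P (coord A) (coord B) = kern P A B := by
  rw [poisson_coord, vectorField_coord]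

/-! ### Coefficients of the λ-bracket as Poisson brackets -/

theorem bracket_apply (P : DiffOp U) (φ ψ : DiffFun U) (L : Lat) :
    bracket P φ ψ L = poisson P (shift L φ) ψ := by
  rw [bracket, Finsupp.sum_apply, poisson, vectorField_eq_sum _ ψ subset_rfl]
  refine Finset.sum_congr rfl fun N _ => ?_
  change _ = _ * grad ψ N
  rw [hamField]
  have h := shift_vectorField L (fun A => kern P A (N - L)) φ
  simp only [shift_kern, sub_add_cancel] at h
  rw [← h, vectorField_eq_sum _ φ subset_rfl]
  beta_reduce
  rw [SkewMonoidAlgebra.sum_def, Finsupp.sum_apply]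
  have h2 : ∀ T p, ((grad φ).sum fun M a => Finsupp.single (N + Multiplicative.toAdd T - M)
      (grad ψ N * shift N p * shift (N + Multiplicative.toAdd T - M) a)) L =
      ∑ M ∈ (grad φ).support, if T = Multiplicative.ofAdd (L + M - N) then
        grad ψ N * shift N p * shift L (pderiv M φ) else 0 := by
    intro T p
    rw [Finsupp.sum_apply]
    refine Finset.sum_congr rfl fun M _ => ?_
    beta_reduce
    rw [Finsupp.single_apply]
    have h3 : N + Multiplicative.toAdd T - M = L ↔ T = Multiplicative.ofAdd (L + M - N) := by
      rw [← Multiplicative.toAdd.injective.eq_iff, toAdd_ofAdd, sub_eq_iff_eq_add,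
        eq_sub_iff_add_eq, add_comm N]
    by_cases h4 : N + Multiplicative.toAdd T - M = L
    · rw [if_pos h4, if_pos (h3.1 h4), h4]; rfl
    · rw [if_neg h4, if_neg (mt h3.2 h4)]
  simp only [h2]
  rw [Finsupp.sum, Finset.sum_comm]
  change _ = shiftHom L _ * _
  rw [map_sum, Finset.sum_mul]
  refine Finset.sum_congr rfl fun M _ => ?_
  change _ = shift L (kern P M (N - L) * pderiv M φ) * _
  rw [shift_mul_apply, shift_kern, sub_add_cancel, kern, Finset.sum_ite_eq', add_comm M L]
  split_ifs with hm
  · ring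
  · rw [Finsupp.notMem_support_iff.1 hm]
    change 0 = shiftHom N 0 * _ * _
    simp

theorem reflect_apply (b : Lat →₀ DiffFun U) (K : Lat) :
    reflect b K = shift K (b (-K)) := by
  rw [reflect, Finsupp.sum_apply, Finsupp.sum]
  have : ∀ L, (Finsupp.single (-L) (shift (-L) (b L)) : Lat →₀ DiffFun U) K =
      if L = -K then shift K (b (-K)) else 0 := by
    intro L
    rw [Finsupp.single_apply]
    by_cases h : L = -K
    · subst h; simp
    · rw [if_neg h, if_neg fun h' => h (by rw [← h', neg_neg])]
  simp only [this]
  rw [Finset.sum_ite_eq']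
  split_ifs with hm
  · rfl
  · rw [Finsupp.notMem_support_iff.1 hm]; rfl

theorem poisson_zero_right (P : DiffOp U) (φ : DiffFun U) : poisson P φ 0 = 0 := map_zero _

theorem poisson_zero_left (P : DiffOp U) (φ : DiffFun U) : poisson P 0 φ = 0 := by
  have : hamField P 0 = 0 := by funext B; exact map_zero _
  rw [poisson, this, vectorField_zero]

theorem sum_single_apply {ι κ τ R : Type*} [DecidableEq τ] [AddCommMonoid R]
    (b : ι →₀ R) (F : R → κ →₀ R) (j : ι → κ → τ) (i₀ : ι) (k₀ : κ)
    (hj : ∀ i k, j i k = j i₀ k₀ ↔ i = i₀ ∧ k = k₀) (hF : F 0 k₀ = 0) :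
    (b.sum fun i c => (F c).sum fun k d => Finsupp.single (j i k) d) (j i₀ k₀) = F (b i₀) k₀ := by
  rw [Finsupp.sum_apply, Finsupp.sum, Finset.sum_eq_single i₀]
  · rw [Finsupp.sum_apply, Finsupp.sum, Finset.sum_eq_single k₀]
    · simp
    · intro k _ hk
      rw [Finsupp.single_apply, if_neg]
      rw [hj]; exact fun h => hk h.2
    · intro h
      rw [Finsupp.notMem_support_iff.1 h]; simp
  · intro i _ hi
    rw [Finsupp.sum_apply, Finsupp.sum, Finset.sum_eq_zero]
    intro k _
    rw [Finsupp.single_apply, if_neg]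
    rw [hj]; exact fun h => hi h.1
  · intro h
    rw [Finsupp.notMem_support_iff.1 h, Finsupp.sum_apply, Finsupp.sum]
    refine Finset.sum_eq_zero fun k _ => ?_
    rw [Finsupp.single_apply]
    split_ifs with hk
    · rw [((hj _ _).1 hk).2, hF]
    · rfl

theorem nestedRight_apply (P : DiffOp U) (φ ψ χ : DiffFun U) (L K : Lat) :
    nestedRight P φ ψ χ (L, K) = poisson P (shift L φ) (poisson P (shift K ψ) χ) := by
  rw [nestedRight, sum_single_apply (bracket P ψ χ) (bracket P φ) (fun K L => (L, K)) K L
    (by simp [and_comm]) (by rw [bracket_apply, poisson_zero_right]), bracket_apply, bracket_apply]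

theorem nestedMiddle_apply (P : DiffOp U) (φ ψ χ : DiffFun U) (L K : Lat) :
    nestedMiddle P φ ψ χ (L, K) = poisson P (shift K ψ) (poisson P (shift L φ) χ) := by
  rw [nestedMiddle, sum_single_apply (bracket P φ χ) (bracket P ψ) (fun L K => (L, K)) L K
    (by simp) (by rw [bracket_apply, poisson_zero_right]), bracket_apply, bracket_apply]

/-- An inner `λ^i` followed by an outer `(λμ)^K` contributes to `λ^(i+K) μ^K`, so the inner index is
`L - K`; the outer shift by `K` then restores `L`. -/
theorem nestedLeft_apply (P : DiffOp U) (φ ψ χ : DiffFun U) (L K : Lat) :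
    nestedLeft P φ ψ χ (L, K) = poisson P (poisson P (shift L φ) (shift K ψ)) χ := by
  have h := sum_single_apply (bracket P φ ψ) (fun c => bracket P c χ) (fun L K => (L + K, K))
    (L - K) K (fun i k => by
      rw [Prod.mk.injEq]
      constructor
      · rintro ⟨h1, rfl⟩; exact ⟨add_right_cancel h1, rfl⟩
      · rintro ⟨rfl, rfl⟩; exact ⟨rfl, rfl⟩)
    (by
      rw [bracket_apply]
      change poisson P 0 χ = 0
      exact poisson_zero_left P χ)
  rw [sub_add_cancel] at h
  rw [nestedLeft, h, bracket_apply, bracket_apply, shift_poisson, shift_shift, sub_add_cancel]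

/-! ### Skewsymmetry and Jacobi on the generators -/

/-- The Jacobiator of the coordinates `u_A`, `u_B`, `u_C`. -/
noncomputable def jacobiator (P : DiffOp U) (A B C : Lat) : DiffFun U :=
  vectorField (kern P A) (kern P B C) + vectorField (kern P B) (kern P C A)
    + vectorField (kern P C) (kern P A B)

theorem hamField_eq (P : DiffOp U) (φ : DiffFun U) (B : Lat) :
    hamField P φ B = poisson P φ (coord B) := (vectorField_coord _ B).symm

/-- A bracket which is skewsymmetric and satisfies the Jacobi identity on the generators is a
multiplicative Poisson vertex algebra structure. -/
theorem isHamiltonian_of_coord {P : DiffOp U} (hs : ∀ A B, kern P A B = -kern P B A)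
    (hJ : ∀ A B C, jacobiator P A B C = 0) : IsHamiltonian P := by
  have anti := poisson_antisymm hs
  -- For fixed `φ` and `ψ`, both sides of Jacobi are vector fields applied to the third argument,
  -- hence agree once they agree on coordinates.
  have step : ∀ φ ψ : DiffFun U, (∀ A, poisson P φ (poisson P ψ (coord A)) -
      poisson P ψ (poisson P φ (coord A)) = poisson P (poisson P φ ψ) (coord A)) →
      ∀ χ, poisson P φ (poisson P ψ χ) - poisson P ψ (poisson P φ χ) =
        poisson P (poisson P φ ψ) χ := by
    intro φ ψ h χ
    rw [poisson, poisson, poisson, poisson, vectorField_commutator]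
    change _ = vectorField (hamField P (poisson P φ ψ)) χ
    congr 2; funext B
    rw [hamField_eq, hamField_eq, hamField_eq]
    exact h B
  -- Under skewsymmetry, Jacobi is invariant under cyclic permutation of its arguments.
  have rot : ∀ φ ψ χ : DiffFun U, poisson P ψ (poisson P χ φ) - poisson P χ (poisson P ψ φ) =
        poisson P (poisson P ψ χ) φ → poisson P φ (poisson P ψ χ) - poisson P ψ (poisson P φ χ) =
        poisson P (poisson P φ ψ) χ := by
    intro φ ψ χ h
    have n : ∀ φ ψ, poisson P φ (-ψ) = -poisson P φ ψ := fun φ ψ => map_neg _ _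
    rw [anti (poisson P φ ψ) χ, anti φ (poisson P ψ χ), ← h, anti φ χ, anti φ ψ, n, n]
    ring
  have h1 : ∀ A B C, poisson P (coord A) (poisson P (coord B) (coord C)) -
      poisson P (coord B) (poisson P (coord A) (coord C)) =
        poisson P (poisson P (coord A) (coord B)) (coord C) := by
    intro A B C
    have h := hJ A B C
    rw [anti (poisson P (coord A) (coord B)), poisson_coord_coord, poisson_coord_coord,
      poisson_coord_coord, poisson_coord, poisson_coord, poisson_coord, hs A C, map_neg]
    rw [jacobiator] at h
    linear_combination h
  -- Coordinates are replaced by arbitrary functions one slot at a time, each slot being rotated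
  -- into the last position.
  have h2 := fun A B => step _ _ (h1 A B)
  have h3 := fun A φ => step (coord A) φ fun B => rot _ _ _ (rot _ _ _ (h2 B A φ))
  have h4 := fun φ ψ => step φ ψ fun A => rot _ _ _ (rot _ _ _ (h3 A φ ψ))
  refine ⟨fun φ ψ => Finsupp.ext fun K => ?_, fun φ ψ χ => Finsupp.ext fun LK => ?_⟩
  · rw [Finsupp.neg_apply, reflect_apply, bracket_apply, bracket_apply, shift_poisson,
      shift_shift, neg_add_cancel, shift_zero_left, anti]
  · obtain ⟨L, K⟩ := LK
    rw [Finsupp.sub_apply, nestedRight_apply, nestedMiddle_apply, nestedLeft_apply, h4]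

theorem IsHamiltonian.kern_antisymm {P : DiffOp U} (h : IsHamiltonian P) (A B : Lat) :
    kern P A B = -kern P B A := by
  have h1 := DFunLike.congr_fun (h.skew gen gen) (A - B)
  rw [Finsupp.neg_apply, reflect_apply, bracket_apply, bracket_apply, shift_poisson,
    shift_shift, neg_add_cancel] at h1
  change poisson P (coord (A - B)) (shift 0 gen) = -poisson P (coord 0) (coord (A - B)) at h1
  change poisson P (coord (A - B)) (coord 0) = _ at h1
  rw [poisson_coord_coord, poisson_coord_coord] at h1
  have h2 := congrArg (shiftHom B) h1
  rw [map_neg] at h2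
  change shift B _ = - shift B _ at h2
  rwa [shift_kern, shift_kern, sub_add_cancel, zero_add] at h2

/-- Placing the third point at the origin loses nothing, by shift invariance; this is the
coefficient of `λ^A μ^B` in the Jacobi identity for the generator. -/
theorem IsHamiltonian.jacobiator_eq_zero {P : DiffOp U} (h : IsHamiltonian P) (A B : Lat) :
    jacobiator P A B 0 = 0 := by
  have hs := h.kern_antisymm
  have h1 := DFunLike.congr_fun (h.jacobi gen gen gen) (A, B)
  rw [Finsupp.sub_apply, nestedRight_apply, nestedMiddle_apply, nestedLeft_apply] at h1
  have h0 : (gen : DiffFun U) = coord 0 := (shift_zero_left gen).symm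
  change poisson P (coord A) (poisson P (coord B) gen) -
    poisson P (coord B) (poisson P (coord A) gen) =
      poisson P (poisson P (coord A) (coord B)) gen at h1
  rw [h0, poisson_antisymm hs (poisson P (coord A) (coord B)), poisson_coord_coord,
    poisson_coord_coord, poisson_coord_coord, poisson_coord, poisson_coord, poisson_coord,
    hs A 0, map_neg] at h1
  rw [jacobiator]
  linear_combination h1

/-! ### The Volterra-type bracket in logarithmic form -/

section Volterra

variable {R : Type*} [CommRing R]

/-- The logarithmic form of the Volterra-type bracket along the direction `e`. -/
def volterra (e : Lat) (η μ : R) (W : Lat → R) (A B : Lat) : R :=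
  (if A - B = (2 : ℤ) • e then η * W (B + (1 : ℤ) • e) else 0)
    - (if B - A = (2 : ℤ) • e then η * W (A + (1 : ℤ) • e) else 0)
    + (if A - B = (1 : ℤ) • e then η * (W A + W B) + μ else 0)
    - (if B - A = (1 : ℤ) • e then η * (W A + W B) + μ else 0)

/-- The derivative of `volterra` along `W_D ↦ W_D k_D`. -/
def volterraDer (e : Lat) (η : R) (W k : Lat → R) (A B : Lat) : R :=
  (if A - B = (2 : ℤ) • e then η * (W (B + (1 : ℤ) • e) * k (B + (1 : ℤ) • e)) else 0)
    - (if B - A = (2 : ℤ) • e then η * (W (A + (1 : ℤ) • e) * k (A + (1 : ℤ) • e)) else 0)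
    + (if A - B = (1 : ℤ) • e then η * (W A * k A + W B * k B) else 0)
    - (if B - A = (1 : ℤ) • e then η * (W A * k A + W B * k B) else 0)

theorem volterra_antisymm (e : Lat) (η μ : R) (W : Lat → R) (A B : Lat) :
    volterra e η μ W A B = -volterra e η μ W B A := by
  rw [volterra, volterra, add_comm (W B)]; ring

/-- The points `A` and `B` are at distance at most two along the direction `e`. -/
def Near (e A B : Lat) : Prop := ∃ k : ℤ, -2 ≤ k ∧ k ≤ 2 ∧ A - B = k • e

theorem Near.symm {e A B : Lat} (h : Near e A B) : Near e B A := by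
  obtain ⟨k, h1, h2, h3⟩ := h
  exact ⟨-k, by omega, by omega, by rw [neg_smul, ← h3, neg_sub]⟩

theorem volterra_of_not_near {e A B : Lat} (η μ : R) (W : Lat → R) (h : ¬ Near e A B) :
    volterra e η μ W A B = 0 := by
  have h' : ¬ Near e B A := mt Near.symm h
  rw [volterra, if_neg fun h0 => h ⟨2, by omega, by omega, h0⟩,
    if_neg fun h0 => h' ⟨2, by omega, by omega, h0⟩,
    if_neg fun h0 => h ⟨1, by omega, by omega, h0⟩,
    if_neg fun h0 => h' ⟨1, by omega, by omega, h0⟩]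
  ring

theorem volterraDer_of_not_near {e A B : Lat} (η : R) (W k : Lat → R) (h : ¬ Near e A B) :
    volterraDer e η W k A B = 0 := by
  have h' : ¬ Near e B A := mt Near.symm h
  rw [volterraDer, if_neg fun h0 => h ⟨2, by omega, by omega, h0⟩,
    if_neg fun h0 => h' ⟨2, by omega, by omega, h0⟩,
    if_neg fun h0 => h ⟨1, by omega, by omega, h0⟩,
    if_neg fun h0 => h' ⟨1, by omega, by omega, h0⟩]
  ring

theorem sub_eq_smul_iff {e : Lat} (he : e ≠ 0) (C : Lat) (i j k : ℤ) :
    (C + i • e) - (C + j • e) = k • e ↔ i - j = k := by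
  rw [add_sub_add_left_eq_sub, ← sub_smul]
  exact (smul_left_injective ℤ he).eq_iff

theorem volterra_line {e : Lat} (he : e ≠ 0) (η μ : R) (W : Lat → R) (C : Lat) (i j : ℤ) :
    volterra e η μ W (C + i • e) (C + j • e) =
  (if i - j = 2 then η * W (C + (j + 1) • e) else 0)
    - (if j - i = 2 then η * W (C + (i + 1) • e) else 0)
    + (if i - j = 1 then η * (W (C + i • e) + W (C + j • e)) + μ else 0)
    - (if j - i = 1 then η * (W (C + i • e) + W (C + j • e)) + μ else 0) := by
  simp only [volterra, sub_eq_smul_iff he, add_assoc, ← add_smul]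

theorem volterraDer_line {e : Lat} (he : e ≠ 0) (η : R) (W k : Lat → R) (C : Lat) (i j : ℤ) :
    volterraDer e η W k (C + i • e) (C + j • e) =
  (if i - j = 2 then η * (W (C + (j + 1) • e) * k (C + (j + 1) • e)) else 0)
    - (if j - i = 2 then η * (W (C + (i + 1) • e) * k (C + (i + 1) • e)) else 0)
    + (if i - j = 1 then η * (W (C + i • e) * k (C + i • e) + W (C + j • e) * k (C + j • e)) else 0)
    - (if j - i = 1 then η * (W (C + i • e) * k (C + i • e) + W (C + j • e) * k (C + j • e))
        else 0) := by
  simp only [volterraDer, sub_eq_smul_iff he, add_assoc, ← add_smul]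

/-- The three points lie on one line in the direction `e`, and the two successive differences take
five values each: finitely many polynomial identities. -/
theorem volterra_jacobi_of_near {e : Lat} (he : e ≠ 0) (η μ : R) (W : Lat → R) {A B C : Lat}
    (hAB : Near e A B) (hBC : Near e B C) :
    volterraDer e η W (volterra e η μ W A) B C + volterraDer e η W (volterra e η μ W B) C A
      + volterraDer e η W (volterra e η μ W C) A B = 0 := by
  obtain ⟨j, h1, h2, h3⟩ := hBC
  obtain ⟨i, h4, h5, h6⟩ := hAB
  obtain rfl : B = C + j • e := by rw [← h3, add_sub_cancel]
  obtain rfl : A = C + (j + i) • e := by rw [add_smul, ← add_assoc, ← h6, add_sub_cancel]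
  have hC : C = C + (0 : ℤ) • e := by simp
  -- The base point is renamed so that the third point alone is rewritten as `D + 0 • e`, giving all
  -- three points the same form.
  generalize hD : C = D
  rw [hD] at hC
  have key : ∀ C', C' = D + (0 : ℤ) • e →
      volterraDer e η W (volterra e η μ W (D + (j + i) • e)) (D + j • e) C'
      + volterraDer e η W (volterra e η μ W (D + j • e)) C' (D + (j + i) • e)
      + volterraDer e η W (volterra e η μ W C') (D + (j + i) • e) (D + j • e) = 0 := by
    rintro C' rfl
    clear h3 h6 hD hC
    simp only [volterraDer_line he, volterra_line he]
    interval_cases i <;> interval_cases j <;> norm_num <;> ring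
  exact key D hC

/-- Two terms vanish because their outer pair is not near. The third differentiates the entry `(B,
C)` along the field of `A`, which is zero at `B`, at `C`, and also at their midpoint when the latter
enters. -/
theorem volterra_jacobi_of_not_near {e : Lat} (η μ : R) (W : Lat → R) {A B C : Lat}
    (hAB : ¬ Near e A B) (hCA : ¬ Near e C A) :
    volterraDer e η W (volterra e η μ W A) B C + volterraDer e η W (volterra e η μ W B) C A
      + volterraDer e η W (volterra e η μ W C) A B = 0 := by
  have hAC : ¬ Near e A C := mt Near.symm hCA
  have mid : ∀ B C, ¬ Near e A B → ¬ Near e A C → B - C = (2 : ℤ) • e →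
      volterra e η μ W A (C + (1 : ℤ) • e) = 0 := by
    intro B C hB hC hBC
    refine volterra_of_not_near η μ W ?_
    rintro ⟨k, h1, h2, h3⟩
    have h4 : A - C = (k + 1) • e := by rw [add_smul, ← h3]; abel
    have h5 : A - B = (k - 1) • e := by
      have : A - B = (A - C) - (B - C) := by abel
      rw [this, h4, hBC, ← sub_smul]; congr 1; ring
    -- A point within two steps of the midpoint is within two steps of an endpoint: of `C` if `k ≤
    -- 1`, of `B` if `k = 2`.
    by_cases h : k ≤ 1
    · exact hC ⟨k + 1, by omega, by omega, h4⟩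
    · exact hB ⟨k - 1, by omega, by omega, h5⟩
  rw [volterraDer_of_not_near η W _ hAB, volterraDer_of_not_near η W _ hCA, volterraDer,
    volterra_of_not_near η μ W hAB, volterra_of_not_near η μ W hAC]
  have h1 : (if B - C = (2 : ℤ) • e then
      η * (W (C + (1 : ℤ) • e) * volterra e η μ W A (C + (1 : ℤ) • e)) else 0) = 0 := by
    split_ifs with h
    · rw [mid B C hAB hAC h]; ring
    · rfl
  have h2 : (if C - B = (2 : ℤ) • e then
      η * (W (B + (1 : ℤ) • e) * volterra e η μ W A (B + (1 : ℤ) • e)) else 0) = 0 := by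
    split_ifs with h
    · rw [mid C B hAC hAB h]; ring
    · rfl
  rw [h1, h2]
  simp

/-- Among the three pairs, two are near or two are not near. Two pairs always share a point, so up
to rotation one of the two preceding cases applies. -/
theorem volterra_jacobi {e : Lat} (he : e ≠ 0) (η μ : R) (W : Lat → R) (A B C : Lat) :
    volterraDer e η W (volterra e η μ W A) B C + volterraDer e η W (volterra e η μ W B) C A
      + volterraDer e η W (volterra e η μ W C) A B = 0 := by
  by_cases hAB : Near e A B <;> by_cases hBC : Near e B C <;> by_cases hCA : Near e C A
  · exact volterra_jacobi_of_near he η μ W hAB hBC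
  · exact volterra_jacobi_of_near he η μ W hAB hBC
  · linear_combination volterra_jacobi_of_near he η μ W hCA hAB
  · linear_combination volterra_jacobi_of_not_near (R := R) η μ W hCA hBC
  · linear_combination volterra_jacobi_of_near he η μ W hBC hCA
  · exact volterra_jacobi_of_not_near (R := R) η μ W hAB hCA
  · linear_combination volterra_jacobi_of_not_near (R := R) η μ W hBC hAB
  · exact volterra_jacobi_of_not_near (R := R) η μ W hAB hCA

theorem derivation_volterra {S : Type*} [CommRing S] [Algebra S R] (X : Derivation S R R)
    {e : Lat} {η μ : R} {W k : Lat → R} {c : R} (hη : X η = 0) (hμ : X μ = 0)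
    (hW : ∀ D, X (W D) = c * (W D * k D)) (A B : Lat) :
    X (volterra e η μ W A B) = c * volterraDer e η W k A B := by
  have h2 : ∀ D, X (η * W D) = c * (η * (W D * k D)) := by
    intro D
    rw [Derivation.leibniz, hη, hW]; simp only [smul_eq_mul]; ring
  have h1 : X (η * (W A + W B) + μ) = c * (η * (W A * k A + W B * k B)) := by
    rw [map_add, hμ, Derivation.leibniz, hη, map_add, hW, hW]; simp only [smul_eq_mul]; ring
  have hi : ∀ (p : Prop) [Decidable p] {r s : R}, X r = c * s →
      X (if p then r else 0) = c * if p then s else 0 := by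
    intro p _ r s hrs
    split_ifs
    · exact hrs
    · rw [map_zero, mul_zero]
  rw [volterra, X.map_sub, X.map_add, X.map_sub, hi _ (h2 _), hi _ (h2 _), hi _ h1, hi _ h1,
    volterraDer]
  ring

end Volterra

/-! ### Volterra-type kernels are Hamiltonian -/

theorem ofFunAt_mul_deriv {f W : ℂ → ℂ} (hf : DifferentiableOn ℂ f U)
    (hW : DifferentiableOn ℂ W U) {a : ℂ} (h : ∀ z ∈ U, f z * deriv W z = a * W z) (D : Lat) :
    ofFunAt f hf D * ofFunAt (deriv W) (hW.deriv U.isOpen) D = a • ofFunAt W hW D := by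
  refine DiffFun.ext fun x => ?_
  change (ofFunAt f hf D).1 x * (ofFunAt (deriv W) _ D).1 x = a * (ofFunAt W hW D).1 x
  rw [ofFunAt_apply, ofFunAt_apply, ofFunAt_apply, h _ (x D).2]

/-- In the Jacobiator, the terms with `f'` cancel by skewsymmetry of `V`. Since `f W' = a W`, the
rest is `a f(u_A) f(u_B) f(u_C)` times the left side of `volterra_jacobi`. -/
theorem isHamiltonian_of_kern_eq_volterra {P : DiffOp U} {f W : ℂ → ℂ}
    (hf : DifferentiableOn ℂ f U) (hW : DifferentiableOn ℂ W U) {a : ℂ}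
    (h : ∀ z ∈ U, f z * deriv W z = a * W z) {e : Lat} (he : e ≠ 0) (η μ : ℂ)
    (hP : ∀ A B, kern P A B = ofFunAt f hf A * ofFunAt f hf B *
      volterra e (algebraMap ℂ _ η) (algebraMap ℂ _ μ) (ofFunAt W hW) A B) : IsHamiltonian P := by
  set V := volterra e (algebraMap ℂ (DiffFun U) η) (algebraMap ℂ _ μ) (ofFunAt W hW) with hV
  have anti : ∀ A B, V A B = -V B A := volterra_antisymm e _ _ _
  refine isHamiltonian_of_coord (fun A B => by rw [hP, hP, anti A B]; ring) fun A B C => ?_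
  have hXV : ∀ A B C, vectorField (kern P A) (V B C) = (a • ofFunAt f hf A) *
      volterraDer e (algebraMap ℂ _ η) (ofFunAt W hW) (V A) B C := by
    intro A B C
    refine derivation_volterra _ (Derivation.map_algebraMap _ _) (Derivation.map_algebraMap _ _)
      (fun D => ?_) B C
    have h1 := ofFunAt_mul_deriv hf hW h D
    rw [vectorField_ofFunAt, hP, smul_mul_assoc, ← mul_smul_comm, ← smul_mul_assoc, ← h1]
    ring
  have hXf : ∀ A B, vectorField (kern P A) (ofFunAt f hf B) =
      ofFunAt f hf A * ofFunAt f hf B * V A B * ofFunAt (deriv f) (hf.deriv U.isOpen) B := by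
    intro A B
    rw [vectorField_ofFunAt, hP]
  have hJ := volterra_jacobi he (algebraMap ℂ (DiffFun U) η) (algebraMap ℂ _ μ)
    (ofFunAt W hW) A B C
  rw [← hV] at hJ
  have ha : ∀ φ : DiffFun U, a • φ = algebraMap ℂ _ a * φ := fun φ => Algebra.smul_def a φ
  simp only [jacobiator, hP B C, hP C A, hP A B, Derivation.leibniz, smul_eq_mul, hXf, hXV, ha]
  rw [anti B A, anti C B, anti A C]
  linear_combination algebraMap ℂ (DiffFun U) a * ofFunAt f hf A * ofFunAt f hf B *
    ofFunAt f hf C * hJ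

/-! Kernels of the operators. -/

theorem kern_add (P Q : DiffOp U) (A B : Lat) : kern (P + Q) A B = kern P A B + kern Q A B := by
  simp [kern, shift_add_apply]

theorem kern_neg (P : DiffOp U) (A B : Lat) : kern (-P) A B = -kern P A B := by
  rw [kern, SkewMonoidAlgebra.coeff_neg]; rfl

theorem kern_sub (P Q : DiffOp U) (A B : Lat) : kern (P - Q) A B = kern P A B - kern Q A B := by
  rw [sub_eq_add_neg, kern_add, kern_neg, sub_eq_add_neg]

theorem kern_smul (c : ℂ) (P : DiffOp U) (A B : Lat) : kern (c • P) A B = c • kern P A B := by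
  rw [kern, SkewMonoidAlgebra.coeff_smul]; rfl

theorem kern_mulOp_mul (f : DiffFun U) (P : DiffOp U) (A B : Lat) :
    kern (mulOp f * P) A B = shift B f * kern P A B := by
  rw [kern, mulOp, SkewMonoidAlgebra.coeff_single_one_mul, shift_mul_apply, kern]

theorem kern_mul_mulOp (f : DiffFun U) (P : DiffOp U) (A B : Lat) :
    kern (P * mulOp f) A B = kern P A B * shift A f := by
  rw [kern, mulOp, SkewMonoidAlgebra.coeff_mul_single_one, shift_mul_apply, kern]
  change _ * shift B (shift (A - B) f) = _
  rw [shift_shift, sub_add_cancel]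

theorem kern_Sh (m n : ℤ) (A B : Lat) :
    kern (Sh U m n) A B = if A - B = (m, n) then 1 else 0 := by
  rw [kern, Sh, SkewMonoidAlgebra.coeff_single, Finsupp.single_apply]
  have : Multiplicative.ofAdd ((m, n) : Lat) = Multiplicative.ofAdd (A - B) ↔ A - B = (m, n) :=
    ⟨fun h => (Multiplicative.ofAdd.injective h).symm, fun h => by rw [h]⟩
  simp only [this]
  split_ifs <;> rfl

theorem kern_mul_Sh (P : DiffOp U) (m n : ℤ) (A B : Lat) :
    kern (P * Sh U m n) A B = kern P (A - (m, n)) B := by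
  rw [kern, Sh, SkewMonoidAlgebra.coeff_mul_single, kern, smul_one, mul_one, sub_right_comm]
  rfl

/-- The coefficients of the constant operator in `generalOp`. -/
def generalCoeff (α β γ δ ε : ℂ) (L : Lat) : ℂ :=
  ((if L = (2, 0) then α else 0) + (if L = (1, 1) then β else 0) + (if L = (0, 2) then γ else 0)
    + (if L = (1, 0) then δ else 0) + (if L = (0, 1) then ε else 0))
  - ((if L = (-2, 0) then α else 0) + (if L = (-1, -1) then β else 0)
    + (if L = (0, -2) then γ else 0) + (if L = (-1, 0) then δ else 0)
    + (if L = (0, -1) then ε else 0))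

theorem generalCoeff_neg (α β γ δ ε : ℂ) (L : Lat) :
    generalCoeff α β γ δ ε (-L) = -generalCoeff α β γ δ ε L := by
  obtain ⟨m, n⟩ := L
  simp only [generalCoeff, Prod.neg_mk, Prod.mk.injEq, neg_eq_iff_eq_neg, neg_neg, neg_zero]
  ring

theorem kern_generalOp {f : ℂ → ℂ} (hf : DifferentiableOn ℂ f U) (α β γ δ ε : ℂ) (A B : Lat) :
    kern (generalOp (ofFun f hf) α β γ δ ε) A B = ofFunAt f hf A * ofFunAt f hf B *
      algebraMap ℂ _ (generalCoeff α β γ δ ε (A - B)) := by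
  have h : ∀ (c : ℂ) (p : Prop) [Decidable p], (c • if p then (1 : DiffFun U) else 0) =
      algebraMap ℂ _ (if p then c else 0) := by
    intro c p _
    split_ifs
    · rw [Algebra.algebraMap_eq_smul_one]
    · simp
  rw [generalOp, kern_mul_mulOp, kern_mulOp_mul]
  simp only [kern_sub, kern_add, kern_smul, kern_Sh, h, ← map_add, ← map_sub]
  change ofFunAt f hf B * algebraMap ℂ _ (generalCoeff α β γ δ ε (A - B)) * ofFunAt f hf A = _
  ring

theorem kern_mulOp (f : DiffFun U) (A B : Lat) :
    kern (mulOp f) A B = if A = B then shift B f else 0 := by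
  have h := kern_mul_mulOp f (Sh U 0 0) A B
  have h1 : Sh U 0 0 = 1 := rfl
  have h2 : A - B = ((0, 0) : Lat) ↔ A = B := sub_eq_zero
  rw [h1, one_mul, ← h1, kern_Sh] at h
  simp only [h2] at h
  rw [h]
  split_ifs with hAB
  · rw [hAB, one_mul]
  · rw [zero_mul]

/-- Multiplication by `W + b` before and after the shift contributes its values at `B` and at `A`,
whence `W_A + W_B` and the constant `2 * b`. -/
theorem kern_oneDimOp {f W : ℂ → ℂ} (hf : DifferentiableOn ℂ f U) (hW : DifferentiableOn ℂ W U)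
    (b : ℂ) (m n : ℤ) (A B : Lat) :
    kern (oneDimOp (Sh U m n) (Sh U (-m) (-n)) (ofFun f hf) (ofFun W hW) b) A B =
      ofFunAt f hf A * ofFunAt f hf B *
        volterra (m, n) (algebraMap ℂ _ 1) (algebraMap ℂ _ (2 * b)) (ofFunAt W hW) A B := by
  have s : ∀ D, shift D (ofFun W hW) = ofFunAt W hW D := fun _ => rfl
  have s' : ∀ D, shift D (ofFun f hf) = ofFunAt f hf D := fun _ => rfl
  have sc : ∀ D (c : ℂ), shift D (algebraMap ℂ (DiffFun U) c) = algebraMap ℂ _ c := fun _ _ => rfl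
  have e' : ((-m, -n) : Lat) = -(m, n) := rfl
  simp only [oneDimOp, kern_add, kern_sub, kern_mul_mulOp, kern_mulOp_mul, kern_mul_Sh, kern_mulOp,
    kern_Sh, shift_add_apply, s, s', sc, e', volterra, map_one, one_mul, map_mul, map_ofNat]
  generalize ((m, n) : Lat) = e
  have c1 : A - e - e = B ↔ A - B = (2 : ℤ) • e := by
    rw [two_smul, sub_sub, sub_eq_iff_eq_add, sub_eq_iff_eq_add, add_comm B]
  have c2 : A - -e - -e = B ↔ B - A = (2 : ℤ) • e := by
    rw [two_smul, sub_neg_eq_add, sub_neg_eq_add, add_assoc, sub_eq_iff_eq_add, eq_comm, add_comm A]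
  have c3 : A - B = -e ↔ B - A = (1 : ℤ) • e := by
    rw [one_smul, ← neg_sub B A, neg_inj]
  have c4 : A - B = e ↔ A - B = (1 : ℤ) • e := by rw [one_smul]
  have c5 : A - e = B ↔ A - B = (1 : ℤ) • e := by
    rw [one_smul, sub_eq_iff_eq_add, sub_eq_iff_eq_add, add_comm B]
  have c6 : A - -e = B ↔ B - A = (1 : ℤ) • e := by
    rw [one_smul, sub_neg_eq_add, sub_eq_iff_eq_add, eq_comm, add_comm A]
  have d1 : (if A - B = (2 : ℤ) • e then ofFunAt f hf B else 0) * ofFunAt W hW (A - e) =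
      (if A - B = (2 : ℤ) • e then ofFunAt W hW (B + (1 : ℤ) • e) else 0) * ofFunAt f hf B := by
    split_ifs with h
    · have : A - e = B + (1 : ℤ) • e := by
        rw [one_smul, sub_eq_iff_eq_add, add_assoc, ← two_smul ℤ, ← h, add_sub_cancel]
      rw [this, mul_comm]
    · rw [zero_mul, zero_mul]
  have d2 : A - -e = A + (1 : ℤ) • e := by rw [one_smul, sub_neg_eq_add]
  have i1 : ∀ (p : Prop) [Decidable p] (r : DiffFun U),
      (if p then r else 0) = (if p then 1 else 0) * r := by
    intro p _ r; split_ifs <;> simp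
  simp only [c1, c2, c3, c4, c5, c6]
  rw [d1, d2]
  rw [i1 (B - A = (2 : ℤ) • e) (ofFunAt f hf B), i1 (A - B = (1 : ℤ) • e) (_ + _),
    i1 (B - A = (1 : ℤ) • e) (_ + _), i1 (B - A = (2 : ℤ) • e) (ofFunAt W hW _),
    i1 (A - B = (1 : ℤ) • e) (ofFunAt W hW A + _ + _),
    i1 (B - A = (1 : ℤ) • e) (ofFunAt W hW A + _ + _)]
  split_ifs <;> ring

/-! ### Polarised Jacobi identity and evaluation at configurations -/

theorem mixed_jacobi {P Q : DiffOp U} (hP : IsHamiltonian P) (hQ : IsHamiltonian Q)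
    (hPQ : IsHamiltonian (P + Q)) (A B : Lat) :
    vectorField (kern P A) (kern Q B 0) + vectorField (kern Q A) (kern P B 0)
      + vectorField (kern P B) (kern Q 0 A) + vectorField (kern Q B) (kern P 0 A)
      + vectorField (kern P 0) (kern Q A B) + vectorField (kern Q 0) (kern P A B) = 0 := by
  have h1 := hP.jacobiator_eq_zero A B
  have h2 := hQ.jacobiator_eq_zero A B
  have h3 := hPQ.jacobiator_eq_zero A B
  have hk : ∀ A, kern (P + Q) A = kern P A + kern Q A := fun A => funext fun B => kern_add P Q A B
  simp only [jacobiator, hk, vectorField_add, Pi.add_apply, map_add] at h1 h2 h3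
  linear_combination h3 - h1 - h2

/-- Evaluation of difference functions at a configuration. -/
def evalAt (x : Lat → U) : DiffFun U →+* ℂ :=
  (Pi.evalRingHom (fun _ : Lat → U => ℂ) x).comp (DiffFun U).val.toRingHom

theorem evalAt_ofFunAt (x : Lat → U) (f : ℂ → ℂ) (hf : DifferentiableOn ℂ f U) (A : Lat) :
    evalAt x (ofFunAt f hf A) = f (x A) := ofFunAt_apply f hf A x

theorem evalAt_algebraMap (x : Lat → U) (c : ℂ) :
    evalAt x (algebraMap ℂ (DiffFun U) c) = c := rfl

theorem exists_line_extension {e : Lat} (he : e ≠ 0) (y : ℤ → U) :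
    ∃ x : Lat → U, ∀ k : ℤ, x (k • e) = y k :=
  ⟨Function.extend (fun k : ℤ => k • e) y fun _ => y 0,
    fun k => (smul_left_injective ℤ he).extend_apply _ _ k⟩

theorem volterra_smul {R : Type*} [CommRing R] {e : Lat} (he : e ≠ 0) (η μ : R) (W : Lat → R)
    (i j : ℤ) :
    volterra e η μ W (i • e) (j • e) =
  (if i - j = 2 then η * W ((j + 1) • e) else 0)
    - (if j - i = 2 then η * W ((i + 1) • e) else 0)
    + (if i - j = 1 then η * (W (i • e) + W (j • e)) + μ else 0)
    - (if j - i = 1 then η * (W (i • e) + W (j • e)) + μ else 0) := by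
  simpa only [zero_add] using volterra_line he η μ W 0 i j

/-! ### Functional equations from particular triples -/

section Necessity

variable {P Q : DiffOp U} {f g W : ℂ → ℂ} {hf : DifferentiableOn ℂ f U}
  {hg : DifferentiableOn ℂ g U} {hW : DifferentiableOn ℂ W U} {b : ℂ} {e : Lat} {c : Lat → ℂ}

/-- `Q` does not couple `A` to the line, so only its entry between `2e` and `0` contributes. It
involves the variables at `0`, `e` and `2e`, hence the three coefficients of the relation. -/
theorem compatible_off_line (hP : IsHamiltonian P) (hQ : IsHamiltonian Q)
    (hPQ : IsHamiltonian (P + Q)) (he : e ≠ 0)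
    (kP : ∀ A B, kern P A B = ofFunAt f hf A * ofFunAt f hf B * algebraMap ℂ _ (c (A - B)))
    (kQ : ∀ A B, kern Q A B = ofFunAt g hg A * ofFunAt g hg B *
      volterra e (algebraMap ℂ _ 1) (algebraMap ℂ _ (2 * b)) (ofFunAt W hW) A B)
    (hc : ∀ L, c (-L) = -c L) {p : ℂ} (hp : p ∈ U) (hfp : f p ≠ 0) (A : Lat)
    (hA : ∀ k : ℤ, A ≠ k • e) :
    c A * ((f p * deriv g p - deriv f p * g p) * g p * W p)
      + c (A - (1 : ℤ) • e) * (f p * deriv W p * g p ^ 2)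
      + c (A - (2 : ℤ) • e) * ((f p * deriv g p - deriv f p * g p) * g p * W p) = 0 := by
  have h := mixed_jacobi hP hQ hPQ A ((2 : ℤ) • e)
  have near : ∀ k : ℤ, ¬ Near e A (k • e) := by
    rintro k ⟨j, -, -, hj⟩
    exact hA (j + k) (by rw [add_smul, ← hj, sub_add_cancel])
  have n0 : ¬ Near e A 0 := by simpa using near 0
  have q1 : ∀ k : ℤ, kern Q A (k • e) = 0 := fun k => by
    rw [kQ, volterra_of_not_near _ _ _ (near k), mul_zero]
  have q2 : kern Q 0 A = 0 := by
    rw [kQ, volterra_of_not_near _ _ _ (mt Near.symm n0), mul_zero]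
  have q3 : kern Q ((2 : ℤ) • e) A = 0 := by
    rw [kQ, volterra_of_not_near _ _ _ (mt Near.symm (near 2)), mul_zero]
  have q4 : kern Q A 0 = 0 := by
    rw [kQ, volterra_of_not_near _ _ _ n0, mul_zero]
  have v20 : kern Q ((2 : ℤ) • e) 0 =
      ofFunAt g hg ((2 : ℤ) • e) * ofFunAt g hg 0 * ofFunAt W hW ((1 : ℤ) • e) := by
    have := volterra_smul he (algebraMap ℂ _ 1) (algebraMap ℂ _ (2 * b)) (ofFunAt W hW) 2 0
    rw [zero_smul] at this
    rw [kQ, this]; norm_num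
  have v02 : kern Q 0 ((2 : ℤ) • e) =
      -(ofFunAt g hg ((2 : ℤ) • e) * ofFunAt g hg 0 * ofFunAt W hW ((1 : ℤ) • e)) := by
    rw [hQ.kern_antisymm, v20]
  rw [q1, q2, v20, kP _ 0, kP 0, kP A ((2 : ℤ) • e)] at h
  simp only [Derivation.leibniz, smul_eq_mul, vectorField_ofFunAt, Derivation.map_algebraMap,
    map_zero, q1, q2, q3, q4, v20, v02] at h
  -- A constant configuration suffices here: what is wanted is a linear relation between the
  -- coefficients.
  have h' := congrArg (evalAt fun _ => (⟨p, hp⟩ : U)) h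
  simp only [kP, map_add, map_mul, map_neg, map_zero, evalAt_ofFunAt, evalAt_algebraMap, sub_zero,
    zero_sub, hc] at h'
  refine (mul_eq_zero.1 ?_).resolve_left hfp
  linear_combination h'

/-- This triple isolates `c(2e)`, and the variable at `2e` separates from the others, so that the
Wronskian factors out. -/
theorem compatible_four_two (hP : IsHamiltonian P) (hQ : IsHamiltonian Q)
    (hPQ : IsHamiltonian (P + Q)) (he : e ≠ 0)
    (kP : ∀ A B, kern P A B = ofFunAt f hf A * ofFunAt f hf B * algebraMap ℂ _ (c (A - B)))
    (kQ : ∀ A B, kern Q A B = ofFunAt g hg A * ofFunAt g hg B *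
      volterra e (algebraMap ℂ _ 1) (algebraMap ℂ _ (2 * b)) (ofFunAt W hW) A B)
    (hc : ∀ L, c (-L) = -c L) (h3 : c ((3 : ℤ) • e) = 0) (h4 : c ((4 : ℤ) • e) = 0) (y : ℤ → U) :
    c ((2 : ℤ) • e) * (f (y 2) * deriv g (y 2) - deriv f (y 2) * g (y 2)) *
      (f (y 4) * g (y 0) * W (y 1) - f (y 0) * g (y 4) * W (y 3)) = 0 := by
  obtain ⟨x, hx⟩ := exists_line_extension he y
  have h := mixed_jacobi hP hQ hPQ ((4 : ℤ) • e) ((2 : ℤ) • e)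
  rw [← zero_smul ℤ e] at h
  have kQ' := fun i j : ℤ => (kQ (i • e) (j • e)).trans
    (congrArg _ (volterra_smul he (algebraMap ℂ _ 1) (algebraMap ℂ _ (2 * b)) (ofFunAt W hW) i j))
  have kP' := fun i j : ℤ => kP (i • e) (j • e)
  have n : ∀ k : ℤ, c (-k • e) = -c (k • e) := fun k => by rw [neg_smul, hc]
  have n2 := n 2
  have n3 := n 3
  have n4 := n 4
  simp only [← sub_smul] at kP'
  simp only [kP', kQ', Derivation.leibniz, smul_eq_mul, vectorField_ofFunAt,
    Derivation.map_algebraMap, map_zero,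
    Int.reduceSub, Int.reduceAdd, Int.reduceEq, Int.reduceNeg, reduceIte, mul_zero, zero_mul,
    add_zero, zero_add, sub_zero, zero_sub] at h
  have h' := congrArg (evalAt x) h
  simp only [map_add, map_mul, map_neg, map_zero, evalAt_ofFunAt, evalAt_algebraMap,
    hx, h3, h4, n2, n3, n4] at h'
  linear_combination h'

theorem compatible_three_two (hP : IsHamiltonian P) (hQ : IsHamiltonian Q)
    (hPQ : IsHamiltonian (P + Q)) (he : e ≠ 0)
    (kP : ∀ A B, kern P A B = ofFunAt f hf A * ofFunAt f hf B * algebraMap ℂ _ (c (A - B)))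
    (kQ : ∀ A B, kern Q A B = ofFunAt g hg A * ofFunAt g hg B *
      volterra e (algebraMap ℂ _ 1) (algebraMap ℂ _ (2 * b)) (ofFunAt W hW) A B)
    (hc : ∀ L, c (-L) = -c L) (h3 : c ((3 : ℤ) • e) = 0) (y : ℤ → U) :
    c ((1 : ℤ) • e) * (f (y 2) * deriv g (y 2) - deriv f (y 2) * g (y 2)) *
        (f (y 3) * g (y 0) * W (y 1))
      + c ((2 : ℤ) • e) * (f (y 3) * f (y 1) * g (y 2) * g (y 0) * deriv W (y 1)
        - f (y 0) * f (y 2) * g (y 2) * g (y 3) * deriv W (y 2)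
        - f (y 0) * (f (y 2) * deriv g (y 2) - deriv f (y 2) * g (y 2)) * g (y 3) *
          (W (y 2) + W (y 3) + 2 * b)) = 0 := by
  obtain ⟨x, hx⟩ := exists_line_extension he y
  have h := mixed_jacobi hP hQ hPQ ((3 : ℤ) • e) ((2 : ℤ) • e)
  rw [← zero_smul ℤ e] at h
  have kQ' := fun i j : ℤ => (kQ (i • e) (j • e)).trans
    (congrArg _ (volterra_smul he (algebraMap ℂ _ 1) (algebraMap ℂ _ (2 * b)) (ofFunAt W hW) i j))
  have kP' := fun i j : ℤ => kP (i • e) (j • e)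
  have n : ∀ k : ℤ, c (-k • e) = -c (k • e) := fun k => by rw [neg_smul, hc]
  have n2 := n 2
  have n3 := n 3
  simp only [← sub_smul] at kP'
  simp only [kP', kQ', Derivation.leibniz, smul_eq_mul, vectorField_ofFunAt,
    Derivation.map_algebraMap, map_zero, map_add,
    Int.reduceSub, Int.reduceAdd, Int.reduceEq, Int.reduceNeg, reduceIte, mul_zero, zero_mul,
    add_zero, zero_add, sub_zero, zero_sub] at h
  have h' := congrArg (evalAt x) h
  simp only [map_add, map_mul, map_neg, map_zero, evalAt_ofFunAt, evalAt_algebraMap,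
    hx, h3, n2, n3] at h'
  linear_combination h'

end Necessity

/-! ### Consequences of the identity theorem -/

theorem eqOn_zero_of_mul_eq_zero (hU : IsConnected (U : Set ℂ)) {f h : ℂ → ℂ}
    (hf : DifferentiableOn ℂ f U) (hh : DifferentiableOn ℂ h U) (hfh : ∀ z ∈ U, f z * h z = 0)
    {p : ℂ} (hp : p ∈ U) (hfp : f p ≠ 0) : ∀ z ∈ U, h z = 0 := by
  refine (hh.analyticOnNhd U.isOpen).eqOn_zero_of_preconnected_of_eventuallyEq_zero
    hU.isPreconnected hp ?_
  filter_upwards [(hf.continuousOn.continuousAt (U.isOpen.mem_nhds hp)).eventually_ne hfp,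
    U.isOpen.mem_nhds hp] with z hz hzU
  exact (mul_eq_zero.1 (hfh z hzU)).resolve_left hz

/-- The quotient `g / f` has zero derivative near `p`, where `f` does not vanish; the
proportionality found there spreads over the connected set `U`. -/
theorem exists_eq_mul_of_wronskian (hU : IsConnected (U : Set ℂ)) {f g : ℂ → ℂ}
    (hf : DifferentiableOn ℂ f U) (hg : DifferentiableOn ℂ g U)
    (h : ∀ z ∈ U, f z * deriv g z - deriv f z * g z = 0) {p : ℂ} (hp : p ∈ U) (hfp : f p ≠ 0) :
    ∃ κ : ℂ, ∀ z ∈ U, g z = κ * f z := by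
  refine ⟨g p / f p, fun z hz => ?_⟩
  obtain ⟨r, hr, hball⟩ := Metric.eventually_nhds_iff_ball.1
    (((hf.continuousOn.continuousAt (U.isOpen.mem_nhds hp)).eventually_ne hfp).and
      (U.isOpen.mem_nhds hp))
  have hd : ∀ z ∈ Metric.ball p r, HasDerivAt (fun z => g z / f z) 0 z := by
    intro z hz
    obtain ⟨h1, h2⟩ := hball z hz
    have hfz := (hf.differentiableAt (U.isOpen.mem_nhds h2)).hasDerivAt
    have hgz := (hg.differentiableAt (U.isOpen.mem_nhds h2)).hasDerivAt
    have := hgz.div hfz h1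
    have h0 : deriv g z * f z - g z * deriv f z = 0 := by linear_combination h z h2
    rwa [h0, zero_div] at this
  have hconst : ∀ z ∈ Metric.ball p r, g z / f z = g p / f p := by
    intro z hz
    exact Metric.isOpen_ball.is_const_of_deriv_eq_zero (convex_ball p r).isPreconnected
      (fun w hw => (hd w hw).differentiableAt.differentiableWithinAt)
      (fun w hw => (hd w hw).deriv) hz (Metric.mem_ball_self hr)
  have h1 := ((hg.sub (hf.const_mul (g p / f p))).analyticOnNhd
    U.isOpen).eqOn_zero_of_preconnected_of_eventuallyEq_zero hU.isPreconnected hp (by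
      filter_upwards [Metric.ball_mem_nhds p hr] with w hw
      have h2 := (div_eq_iff (hball w hw).1).1 (hconst w hw)
      simp [h2])
  have h2 : g z - g p / f p * f z = 0 := h1 hz
  linear_combination h2

/-! ### The differential equation of the power -/

section PowBranch

variable {g F W : ℂ → ℂ} {a : ℂ}

/-- With `F = exp L`, the equation for `F` says `g L' = 1`; differentiating `W = exp (a L)` gives
the rest. -/
theorem IsPowBranch.mul_deriv_of_ne_zero (hWF : IsPowBranch U F a W)
    (hFeq : ∀ z ∈ U, g z * deriv F z = F z) {z : ℂ} (hz : z ∈ U) (hFz : F z ≠ 0) :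
    W z ≠ 0 ∧ g z * deriv W z = a * W z := by
  obtain ⟨L, hL, hev⟩ := hWF z hz hFz
  have hLd := hL.differentiableAt.hasDerivAt
  have hF' : deriv F z = Complex.exp (L z) * deriv L z :=
    (Filter.EventuallyEq.deriv_eq (hev.mono fun w hw => hw.1)).trans hLd.cexp.deriv
  have hW' : deriv W z = Complex.exp (a * L z) * (a * deriv L z) :=
    (Filter.EventuallyEq.deriv_eq (hev.mono fun w hw => hw.2)).trans
      (hLd.const_mul a).cexp.deriv
  obtain ⟨h1, h2⟩ := hev.self_of_nhds
  refine ⟨by rw [h2]; exact Complex.exp_ne_zero _, ?_⟩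
  have h3 := hFeq z hz
  rw [hF', h1] at h3
  have h4 : g z * deriv L z = 1 :=
    mul_left_cancel₀ (Complex.exp_ne_zero (L z)) (by linear_combination h3)
  rw [hW', h2]
  linear_combination a * Complex.exp (a * L z) * h4

theorem IsPowBranch.mul_deriv (hU : IsConnected (U : Set ℂ)) (hg : DifferentiableOn ℂ g U)
    (hF : DifferentiableOn ℂ F U) (hW : DifferentiableOn ℂ W U) (hWF : IsPowBranch U F a W)
    (hFeq : ∀ z ∈ U, g z * deriv F z = F z) {p : ℂ} (hp : p ∈ U) (hFp : F p ≠ 0) :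
    ∀ z ∈ U, g z * deriv W z = a * W z := by
  have h := eqOn_zero_of_mul_eq_zero hU hF
    ((hg.mul (hW.deriv U.isOpen)).sub (hW.const_mul a)) (fun z hz => ?_) hp hFp
  · intro z hz
    exact sub_eq_zero.1 (h z hz)
  · by_cases hFz : F z = 0
    · rw [hFz, zero_mul]
    · have := (hWF.mul_deriv_of_ne_zero hFeq hz hFz).2
      simp [this]

end PowBranch

/-! ### Necessary and sufficient conditions along one direction -/

section CompatibilityConditions

variable {f g W : ℂ → ℂ}

/-- The necessary conditions for the compatibility of a constant-coefficient bracket and a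
Volterra-type bracket. -/
theorem compatible_necessary {P Q : DiffOp U} {hf : DifferentiableOn ℂ f U}
    {hg : DifferentiableOn ℂ g U} {hW : DifferentiableOn ℂ W U} {a b : ℂ} {e : Lat} {c : Lat → ℂ}
    (hPQ : Compatible P Q) (he : e ≠ 0)
    (kP : ∀ A B, kern P A B = ofFunAt f hf A * ofFunAt f hf B * algebraMap ℂ _ (c (A - B)))
    (kQ : ∀ A B, kern Q A B = ofFunAt g hg A * ofFunAt g hg B *
      volterra e (algebraMap ℂ _ 1) (algebraMap ℂ _ (2 * b)) (ofFunAt W hW) A B)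
    (hc : ∀ L, c (-L) = -c L) (h3 : c ((3 : ℤ) • e) = 0) (h4 : c ((4 : ℤ) • e) = 0)
    (hgW : ∀ z ∈ U, g z * deriv W z = a * W z)
    (hU : IsConnected (U : Set ℂ)) {p : ℂ} (hp : p ∈ U) (hfp : f p ≠ 0) (hgp : g p ≠ 0)
    (hWp : W p ≠ 0) (hWp' : deriv W p ≠ 0) :
    c ((2 : ℤ) • e) = 0 ∧ (c ((1 : ℤ) • e) = 0 ∨ ∃ κ : ℂ, ∀ z ∈ U, g z = κ * f z) ∧
      ∃ d w : ℂ, w ≠ 0 ∧ ∀ A, (∀ k : ℤ, A ≠ k • e) →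
        c A * d + c (A - (1 : ℤ) • e) * w + c (A - (2 : ℤ) • e) * d = 0 := by
  obtain ⟨hP, hQ, hη⟩ := hPQ
  have hH : IsHamiltonian (P + Q) := by simpa using hη 1
  have nonconst : ¬ ∀ z ∈ U, W z = W p := by
    intro h
    have : W =ᶠ[nhds p] fun _ => W p := by
      filter_upwards [U.isOpen.mem_nhds hp] with z hz using h z hz
    exact hWp' (by rw [this.deriv_eq, deriv_const])
  have h2 : c ((2 : ℤ) • e) = 0 := by
    by_contra hα
    have hD : ∀ z ∈ U, f z * deriv g z - deriv f z * g z = 0 := by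
      intro z hz
      by_contra hD
      refine nonconst fun z₁ hz₁ => ?_
      -- With `z` at `2e`, `z₁` at `e` and `p` elsewhere, a nonzero Wronskian at `z` would give `W
      -- z₁ = W p` for every `z₁`.
      have h := compatible_four_two hP hQ hH he kP kQ hc h3 h4
        fun k => if k = 2 then ⟨z, hz⟩ else if k = 1 then ⟨z₁, hz₁⟩ else ⟨p, hp⟩
      norm_num at h
      rcases h with (h | h) | h
      · exact absurd h hα
      · exact absurd h hD
      · exact mul_left_cancel₀ (mul_ne_zero hfp hgp) (by linear_combination h)
    obtain ⟨κ, hκ⟩ := exists_eq_mul_of_wronskian hU hf hg hD hp hfp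
    -- With the Wronskian zero, varying only the variable at `e` shows `f W'` to be constant. Since
    -- `a W = g W' = κ f W'`, `W` would be constant as well.
    have hfW : ∀ z ∈ U, f z * deriv W z = f p * deriv W p := by
      intro z hz
      have h := compatible_three_two hP hQ hH he kP kQ hc h3
        fun k => if k = 1 then ⟨z, hz⟩ else ⟨p, hp⟩
      norm_num [hD p hp] at h
      have h := h.resolve_left hα
      exact mul_left_cancel₀ (mul_ne_zero hfp (mul_ne_zero hgp hgp)) (by linear_combination h)
    refine nonconst fun z hz => ?_
    have ha : a ≠ 0 := by
      rintro rfl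
      have := hgW p hp
      rw [zero_mul] at this
      exact mul_ne_zero hgp hWp' this
    refine mul_left_cancel₀ ha ?_
    rw [← hgW z hz, ← hgW p hp, hκ z hz, hκ p hp]
    linear_combination κ * hfW z hz
  refine ⟨h2, ?_, ?_⟩
  · by_cases h1 : c ((1 : ℤ) • e) = 0
    · exact Or.inl h1
    · refine Or.inr (exists_eq_mul_of_wronskian hU hf hg (fun z hz => ?_) hp hfp)
      have h := compatible_three_two hP hQ hH he kP kQ hc h3
        fun k => if k = 2 then ⟨z, hz⟩ else ⟨p, hp⟩
      simp only [h2, zero_mul, add_zero] at h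
      norm_num [hfp, hgp, hWp] at h
      exact h.resolve_left (by simpa using h1)
  · exact ⟨_, _, mul_ne_zero (mul_ne_zero hfp hWp') (pow_ne_zero 2 hgp),
      compatible_off_line hP hQ hH he kP kQ hc hp hfp⟩

/-- The multiples of the first-order bracket are compatible with the Volterra-type bracket. -/
theorem compatible_of_eq_mul {P Q : DiffOp U} {hf : DifferentiableOn ℂ f U}
    {hg : DifferentiableOn ℂ g U} {hW : DifferentiableOn ℂ W U} {a b : ℂ} {e : Lat} {c : Lat → ℂ}
    (he : e ≠ 0)
    (kP : ∀ A B, kern P A B = ofFunAt f hf A * ofFunAt f hf B * algebraMap ℂ _ (c (A - B)))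
    (kQ : ∀ A B, kern Q A B = ofFunAt g hg A * ofFunAt g hg B *
      volterra e (algebraMap ℂ _ 1) (algebraMap ℂ _ (2 * b)) (ofFunAt W hW) A B)
    (hgW : ∀ z ∈ U, g z * deriv W z = a * W z) {δ κ : ℂ}
    (hκ : κ ≠ 0) (hgf : ∀ z ∈ U, g z = κ * f z)
    (hc : ∀ L, c L = (if L = (1 : ℤ) • e then δ else 0) - if -L = (1 : ℤ) • e then δ else 0) :
    Compatible P Q := by
  -- A combination of the two kernels is again of Volterra type: rescaling `f` to `g` turns `δ` into
  -- `δ / κ²`, which only changes the constant term.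
  have key : ∀ s t : ℂ, ∀ A B, algebraMap ℂ _ s * kern P A B + algebraMap ℂ _ t * kern Q A B =
      ofFunAt g hg A * ofFunAt g hg B * volterra e (algebraMap ℂ _ t)
        (algebraMap ℂ _ (s * δ * (κ⁻¹ * κ⁻¹) + t * (2 * b))) (ofFunAt W hW) A B := by
    intro s t A B
    have hgf' : ∀ D, ofFunAt f hf D = algebraMap ℂ _ κ⁻¹ * ofFunAt g hg D := by
      intro D
      refine DiffFun.ext fun x => ?_
      change _ = κ⁻¹ * (ofFunAt g hg D).1 x
      rw [ofFunAt_apply, ofFunAt_apply, hgf _ (x D).2, inv_mul_cancel_left₀ hκ]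
    rw [kP, kQ, hc, hgf' A, hgf' B, neg_sub, volterra, volterra]
    split_ifs <;> simp only [map_add, map_sub, map_mul, map_one, map_zero] <;> ring
  refine ⟨?_, ?_, fun η => ?_⟩
  · refine isHamiltonian_of_kern_eq_volterra hg hW hgW he 0
      (1 * δ * (κ⁻¹ * κ⁻¹) + 0 * (2 * b)) fun A B => ?_
    rw [← key 1 0 A B]; simp
  · exact isHamiltonian_of_kern_eq_volterra hg hW hgW he _ _ kQ
  · refine isHamiltonian_of_kern_eq_volterra hg hW hgW he η
      (1 * δ * (κ⁻¹ * κ⁻¹) + η * (2 * b)) fun A B => ?_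
    rw [← key 1 η A B, kern_add, kern_smul, Algebra.smul_def, map_one, one_mul]

end CompatibilityConditions

end DiffHam

/-! ### Solving for the coefficients of the constant operator -/

open DiffHam in
theorem mainTheorem6 (U : TopologicalSpace.Opens ℂ) (hU : IsConnected (U : Set ℂ))
    (f₁ f₂ F W : ℂ → ℂ) (hf₁ : DifferentiableOn ℂ f₁ U) (hf₂ : DifferentiableOn ℂ f₂ U)
    (hF : DifferentiableOn ℂ F U) (hW : DifferentiableOn ℂ W U)
    (α β γ δ ε a b : ℂ) (ha : a ≠ 0)
    (hFeq : ∀ z ∈ U, f₂ z * deriv F z = F z)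
    (hFnc : ¬ ∃ c : ℂ, ∀ z ∈ U, F z = c)
    (hWF : IsPowBranch U F a W)
    (hP : generalOp (ofFun f₁ hf₁) α β γ δ ε ≠ 0) :
    (Compatible (generalOp (ofFun f₁ hf₁) α β γ δ ε) (oneDimOp₁ (ofFun f₂ hf₂) (ofFun W hW) b) ↔
      (∃ κ : ℂ, ∀ z ∈ U, f₂ z = κ * f₁ z) ∧ α = 0 ∧ β = 0 ∧ γ = 0 ∧ ε = 0) ∧
    (Compatible (generalOp (ofFun f₁ hf₁) α β γ δ ε) (oneDimOp₂ (ofFun f₂ hf₂) (ofFun W hW) b) ↔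
      (∃ κ : ℂ, ∀ z ∈ U, f₂ z = κ * f₁ z) ∧ α = 0 ∧ β = 0 ∧ γ = 0 ∧ δ = 0) := by
  have hf₁0 : ∃ q ∈ U, f₁ q ≠ 0 := by
    by_contra! h
    have h0 : ofFun f₁ hf₁ = 0 := DiffFun.ext fun x => h _ (x 0).2
    refine hP ?_
    rw [generalOp, h0, mulOp, SkewMonoidAlgebra.single_zero, zero_mul, zero_mul]
  obtain ⟨q, hq, hf₁q⟩ := hf₁0
  -- Neither `f₁` nor `F` vanishes identically, so neither does their product; at such a point `f₂`,
  -- `W` and `W'` are nonzero too.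
  have hp : ∃ p ∈ U, f₁ p ≠ 0 ∧ F p ≠ 0 := by
    by_contra! h
    refine hFnc ⟨0, eqOn_zero_of_mul_eq_zero hU hf₁ hF (fun z hz => ?_) hq hf₁q⟩
    by_cases hz0 : f₁ z = 0
    · rw [hz0, zero_mul]
    · rw [h z hz hz0, mul_zero]
  obtain ⟨p, hp, hf₁p, hFp⟩ := hp
  have hf₂p : f₂ p ≠ 0 := fun h => hFp (by rw [← hFeq p hp, h, zero_mul])
  have hgW := hWF.mul_deriv hU hf₂ hF hW hFeq hp hFp
  have hWp : W p ≠ 0 := (hWF.mul_deriv_of_ne_zero hFeq hp hFp).1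
  have hWp' : deriv W p ≠ 0 := by
    intro h
    have := hgW p hp
    rw [h, mul_zero] at this
    exact mul_ne_zero ha hWp this.symm
  have hκ0 : ∀ κ : ℂ, (∀ z ∈ U, f₂ z = κ * f₁ z) → κ ≠ 0 := by
    rintro κ h rfl
    exact hf₂p (by rw [h p hp, zero_mul])
  have hcoef : ¬ (α = 0 ∧ β = 0 ∧ γ = 0 ∧ δ = 0 ∧ ε = 0) := by
    rintro ⟨rfl, rfl, rfl, rfl, rfl⟩
    refine hP (SkewMonoidAlgebra.ext fun L => ?_)
    have h := kern_generalOp hf₁ 0 0 0 0 0 L.toAdd 0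
    rw [kern, shift_zero_left, sub_zero, ofAdd_toAdd] at h
    simp [h, generalCoeff]
  have kP := kern_generalOp hf₁ α β γ δ ε
  have hodd := generalCoeff_neg α β γ δ ε
  refine ⟨⟨fun h => ?_, ?_⟩, ⟨fun h => ?_, ?_⟩⟩
  · obtain ⟨h2, h1, d, w, hw, hoff⟩ := compatible_necessary h (e := (1, 0)) (by simp) kP
      (kern_oneDimOp hf₂ hW b 1 0) hodd (by simp [generalCoeff]) (by simp [generalCoeff]) hgW hU
      hp hf₁p hf₂p hWp hWp'
    have off : ∀ m n : ℤ, n ≠ 0 → generalCoeff α β γ δ ε (m, n) * d +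
        generalCoeff α β γ δ ε (m - 1, n) * w + generalCoeff α β γ δ ε (m - 2, n) * d = 0 := by
      intro m n hn
      simpa using hoff (m, n) fun k hk => hn (by simpa using congrArg Prod.snd hk)
    -- The row at height one carries `ε` at `0` and `β` at `1`: `o0` reads `ε d = 0`, and when `d =
    -- 0` the relation `o1` gives `ε w = 0`. Then `o2` kills `β`, and `o3` kills `γ`, alone in the
    -- row at height two.
    have o0 := off 0 1 one_ne_zero
    have o1 := off 1 1 one_ne_zero
    have o2 := off 2 1 one_ne_zero
    have o3 := off 1 2 two_ne_zero
    simp [generalCoeff] at h2 h1 o0 o1 o2 o3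
    have hv : ε = 0 := o0.elim id fun hd => by
      rw [hd, mul_zero, zero_add] at o1
      exact (mul_eq_zero.1 o1).resolve_right hw
    have hβ : β = 0 := by
      rw [hv, zero_mul, add_zero] at o2
      exact (mul_eq_zero.1 o2).resolve_right hw
    have ho : γ = 0 := o3.resolve_right hw
    -- All other coefficients vanish, so `δ = 0` would contradict `P ≠ 0`; the alternative is
    -- proportionality.
    exact ⟨h1.resolve_left fun hk => hcoef ⟨h2, hβ, ho, hk, hv⟩, h2, hβ, ho, hv⟩
  · rintro ⟨⟨κ, hκ⟩, rfl, rfl, rfl, rfl⟩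
    refine compatible_of_eq_mul (e := (1, 0)) (δ := δ) (by simp) kP
      (kern_oneDimOp hf₂ hW b 1 0) hgW (hκ0 κ hκ) hκ fun L => ?_
    obtain ⟨m, n⟩ := L
    simp [generalCoeff, neg_eq_iff_eq_neg]
  · obtain ⟨h2, h1, d, w, hw, hoff⟩ := compatible_necessary h (e := (0, 1)) (by simp) kP
      (kern_oneDimOp hf₂ hW b 0 1) hodd (by simp [generalCoeff]) (by simp [generalCoeff]) hgW hU
      hp hf₁p hf₂p hWp hWp'
    have off : ∀ m n : ℤ, m ≠ 0 → generalCoeff α β γ δ ε (m, n) * d +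
        generalCoeff α β γ δ ε (m, n - 1) * w + generalCoeff α β γ δ ε (m, n - 2) * d = 0 := by
      intro m n hn
      simpa using hoff (m, n) fun k hk => hn (by simpa using congrArg Prod.fst hk)
    -- The same argument on columns: `δ` and `β` occupy the first, `α` alone the second.
    have o0 := off 1 0 one_ne_zero
    have o1 := off 1 1 one_ne_zero
    have o2 := off 1 2 one_ne_zero
    have o3 := off 2 1 two_ne_zero
    simp [generalCoeff] at h2 h1 o0 o1 o2 o3
    have hv : δ = 0 := o0.elim id fun hd => by
      rw [hd, mul_zero, zero_add] at o1
      exact (mul_eq_zero.1 o1).resolve_right hw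
    have hβ : β = 0 := by
      rw [hv, zero_mul, add_zero] at o2
      exact (mul_eq_zero.1 o2).resolve_right hw
    have ho : α = 0 := o3.resolve_right hw
    exact ⟨h1.resolve_left fun hk => hcoef ⟨ho, hβ, h2, hv, hk⟩, ho, hβ, h2, hv⟩
  · rintro ⟨⟨κ, hκ⟩, rfl, rfl, rfl, rfl⟩
    refine compatible_of_eq_mul (e := (0, 1)) (δ := ε) (by simp) kP
      (kern_oneDimOp hf₂ hW b 0 1) hgW (hκ0 κ hκ) hκ fun L => ?_
    obtain ⟨m, n⟩ := L
    simp [generalCoeff, neg_eq_iff_eq_neg]
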